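/- Let $0<q<1$, $x(s)=\frac12(q^s+q^{-s})$, and let $\mathcal D_q,\mathcal S_q$ be the linear operators on $\mathbb C[z]$ determined by $$\mathcal D_q p(x(s))=\frac{p(x(s+\frac12))-p(x(s-\frac12))}{x(s+\frac12)-x(s-\frac12)},\qquad \mathcal S_q p(x(s))=\tfrac12\big(p(x(s+\tfrac12))+p(x(s-\tfrac12))\big).$$ For a linear functional $\mathbf u:\mathbb C[z]\to\mathbb C$ and a polynomial $\phi$, define $\langle\phi\mathbf u,f\rangle=\langle\mathbf u,\phi f\rangle$, $\langle\mathbf D_q\mathbf u,f\rangle=-\langle\mathbf u,\mathcal D_qf\rangle$ and $\langle\mathbf S_q\mathbf u,f\rangle=\langle\mathbf u,\mathcal S_qf\rangle$. For $n\in\mathbb Z$ put $\alpha_n=\frac12(q^{n/2}+q^{-n/2})$, $\gamma_n=\frac{q^{n/2}-q^{-n/2}}{q^{1/2}-q^{-1/2}}$, and $\alpha=\alpha_1$. Let $(P_n)_{n\ge0}$ be a monic orthogonal polynomial sequence with respect to a linear functional $\mathbf u$ (that is, $P_n$ is monic of degree $n$, $\langle\mathbf u,P_nP_m\rangle=0$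 for $n\ne m$, and $\langle\mathbf u,P_n^2\rangle\neq0$), with recurrence $P_{n+1}(z)=(z-B_n)P_n(z)-C_nP_{n-1}(z)$, $P_{-1}=0$. Suppose that there are $a,b,c\in\mathbb C$ and complex sequences $(a_n),(b_n),(c_n)$ with $c_n\neq0$ for all $n\ge0$ such that $$(az^2+bz+c)\,\mathcal D_qP_n(z)=a_n\mathcal S_qP_{n+1}(z)+b_n\mathcal S_qP_n(z)+c_n\mathcal S_qP_{n-1}(z)\qquad(n=0,1,2,\dots).$$ Put $r_i=c_i+2aC_i$ for $i=2,3$, and suppose that, if $a\neq0$, $$(4\alpha^2-1)aC_2C_3+\frac{r_3}{2}\Big[(B_0+B_1)^2+4\alpha^2(C_1-B_0B_1+\alpha^2-1)-2(2\alpha^2-1)C_2\Big]=0,$$ and that (for every $a$) $$aC_2C_3\Big(b_2+2aB_2+\frac b\alpha\Big)-r_3\Big(a(B_2+B_1)C_2+\frac b\alpha C_2-\frac{r_2}{2}(B_1-B_0)\Big)=0.$$ Then $r_3\neq0$. Put $$\mathfrak a=-\frac{aC_3+(\alpha^2-1)r_3}{\alpha r_3},\qquad \mathfrak b=-\frac1{2\alpha}\Big(\Big(1-2a\frac{C_3}{r_3}\Big)(B_0+B_1)-2\alpha^2B_0\Big),$$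 $$\mathfrak c=-\frac1{2\alpha}\Big(\Big(1-2a\frac{C_3}{r_3}\Big)(C_1-B_0B_1)+C_1+B_0^2\Big),$$ $\phi(z)=\mathfrak az^2+\mathfrak bz+\mathfrak c$ and $\psi(z)=z-B_0$. The following hold. 1. The $P_n$ are multiples of Askey–Wilson polynomials, or special or limiting cases of them, in the following sense. For $t=(t_0,t_1,t_2,t_3)\in\mathbb C^4$ with $t_0\ne0$ let $$p_n(z;t|q)=t_0^{-n}\sum_{k=0}^n\frac{(q^{-n},\,t_0t_1t_2t_3q^{n-1};q)_k}{(q;q)_k}\,q^k\,(t_0t_1q^k,\,t_0t_2q^k,\,t_0t_3q^k;q)_{n-k}\prod_{j=0}^{k-1}\big(1-2t_0q^jz+t_0^2q^{2j}\big),$$ where $(x;q)_k=\prod_{j=0}^{k-1}(1-xq^j)$ and $(x,y,\dots;q)_k=(x;q)_k(y;q)_k\cdots$; this is the Askey–Wilson polynomial. Then at least one of the following is true: * there is $t\in\mathbb C^4$ with $t_0\neq0$ such that, for every $n$, $P_n$ is a nonzero multiple of $p_n(\cdot;t|q)$; * there are nonzero constants $\kappa_n(t)$ such that, for every $n$, $P_n$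 is the coefficientwise limit of $\kappa_n(t)\,p_n(\cdot;t|q)$ as all four $t_i$ tend to $0$ through nonzero values; * there are a nonempty $I\subseteq\{0,1,2,3\}$, fixed nonzero values $t_i$ for $i\notin I$, and nonzero constants $\kappa_n(t)$ such that, for every $n$, $P_n$ is the coefficientwise limit of $\kappa_n(t)\,p_n(\cdot;t|q)$ as the $t_i$ with $i\in I$ tend independently to $\infty$. 2. $\mathbf D_q(\phi\mathbf u)=\mathbf S_q(\psi\mathbf u)$. 3. For every $n\ge0$, $\phi\,\mathcal D_q^2P_n+\psi\,\mathcal S_q\mathcal D_qP_n=\lambda_nP_n$ with $\lambda_n=\gamma_n(\mathfrak a\gamma_{n-1}+\alpha_{n-1})$. -/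

import Mathlib

open Polynomial Filter Topology

noncomputable section

namespace AskeyWilson

/-- `α_n = (q^{n/2} + q^{-n/2}) / 2`, for every integer `n`. -/
def alpha (q : ℝ) (n : ℤ) : ℂ :=
  (((q ^ ((n : ℝ) / 2) + q ^ (-((n : ℝ) / 2))) / 2 : ℝ) : ℂ)

/-- `γ_n = (q^{n/2} - q^{-n/2}) / (q^{1/2} - q^{-1/2})`, for every integer `n`. -/
def gamma (q : ℝ) (n : ℤ) : ℂ :=
  (((q ^ ((n : ℝ) / 2) - q ^ (-((n : ℝ) / 2))) /
    (q ^ ((1 : ℝ) / 2) - q ^ (-((1 : ℝ) / 2))) : ℝ) : ℂ)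

/-- The pair `(D_q z^n, S_q z^n)`, computed by the product rules
`D_q (z f) = S_q f + α z D_q f` and `S_q (z f) = (α² - 1) (z² - 1) D_q f + α z S_q f`.
The theorems `eval_Dq` and `eval_Sq` below show that these are the divided difference and
the average on the lattice `x(s) = (q^s + q^{-s}) / 2`. -/
def monomialPair (q : ℝ) : ℕ → ℂ[X] × ℂ[X]
  | 0 => (0, 1)
  | n + 1 =>
    ((monomialPair q n).2 + C (alpha q 1) * X * (monomialPair q n).1,
      C (alpha q 1 ^ 2 - 1) * (X ^ 2 - 1) * (monomialPair q n).1
        + C (alpha q 1) * X * (monomialPair q n).2)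

/-- The Askey-Wilson operator on polynomials. -/
def Dq (q : ℝ) : ℂ[X] →ₗ[ℂ] ℂ[X] :=
  (Polynomial.basisMonomials ℂ).constr ℂ (fun n => (monomialPair q n).1)

/-- The averaging operator on polynomials. -/
def Sq (q : ℝ) : ℂ[X] →ₗ[ℂ] ℂ[X] :=
  (Polynomial.basisMonomials ℂ).constr ℂ (fun n => (monomialPair q n).2)

/-- The lattice `x(s) = (q^s + q^{-s}) / 2`, in terms of `w = q^s ≠ 0`. -/
def lattice (w : ℂ) : ℂ := (w + w⁻¹) / 2

/-- `q^{1/2}`. -/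
def sqrtQ (q : ℝ) : ℂ := ((q ^ ((1 : ℝ) / 2) : ℝ) : ℂ)

theorem Dq_X_pow (q : ℝ) (n : ℕ) : Dq q (X ^ n) = (monomialPair q n).1 := by
  have h := (Polynomial.basisMonomials ℂ).constr_basis ℂ (fun n => (monomialPair q n).1) n
  simpa [Dq, Polynomial.coe_basisMonomials, Polynomial.X_pow_eq_monomial] using h

theorem Sq_X_pow (q : ℝ) (n : ℕ) : Sq q (X ^ n) = (monomialPair q n).2 := by
  have h := (Polynomial.basisMonomials ℂ).constr_basis ℂ (fun n => (monomialPair q n).2) n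
  simpa [Sq, Polynomial.coe_basisMonomials, Polynomial.X_pow_eq_monomial] using h

theorem sqrtQ_ne_zero {q : ℝ} (hq : 0 < q) : sqrtQ q ≠ 0 := by
  have : 0 < q ^ ((1 : ℝ) / 2) := Real.rpow_pos_of_pos hq _
  simpa [sqrtQ] using this.ne'

theorem alpha_one {q : ℝ} (hq : 0 < q) : alpha q 1 = (sqrtQ q + (sqrtQ q)⁻¹) / 2 := by
  simp [alpha, sqrtQ, Real.rpow_neg hq.le]

theorem monomialPair_eval {q : ℝ} (hq : 0 < q) {w : ℂ} (hw : w ≠ 0) (n : ℕ) :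
    (lattice (w * sqrtQ q) - lattice (w / sqrtQ q)) * (monomialPair q n).1.eval (lattice w)
        = lattice (w * sqrtQ q) ^ n - lattice (w / sqrtQ q) ^ n ∧
      (monomialPair q n).2.eval (lattice w)
        = (lattice (w * sqrtQ q) ^ n + lattice (w / sqrtQ q) ^ n) / 2 := by
  have hs := sqrtQ_ne_zero hq
  have e1 : alpha q 1 * lattice w = (lattice (w * sqrtQ q) + lattice (w / sqrtQ q)) / 2 := by
    rw [alpha_one hq]; unfold lattice; field_simp; ring
  have e2 : (alpha q 1 ^ 2 - 1) * (lattice w ^ 2 - 1)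
      = (lattice (w * sqrtQ q) - lattice (w / sqrtQ q)) ^ 2 / 4 := by
    rw [alpha_one hq]; unfold lattice; field_simp; ring
  generalize lattice (w * sqrtQ q) = u at *
  generalize lattice (w / sqrtQ q) = v at *
  induction n with
  | zero => simp [monomialPair]
  | succ n ih =>
    obtain ⟨h1, h2⟩ := ih
    simp only [monomialPair, eval_add, eval_mul, eval_C, eval_X, eval_sub, eval_pow, eval_one]
    rw [e1, e2]
    constructor
    · linear_combination (u - v) * h2 + (u + v) / 2 * h1
    · linear_combination (u - v) / 4 * h1 + (u + v) / 2 * h2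

/-- `D_q p (x(s)) = (p(x(s+1/2)) - p(x(s-1/2))) / (x(s+1/2) - x(s-1/2))`, with `w = q^s`. -/
theorem eval_Dq {q : ℝ} (hq : 0 < q) {w : ℂ} (hw : w ≠ 0)
    (hne : lattice (w * sqrtQ q) ≠ lattice (w / sqrtQ q)) (p : ℂ[X]) :
    (Dq q p).eval (lattice w)
      = (p.eval (lattice (w * sqrtQ q)) - p.eval (lattice (w / sqrtQ q)))
        / (lattice (w * sqrtQ q) - lattice (w / sqrtQ q)) := by
  rw [eq_div_iff (sub_ne_zero.mpr hne)]
  induction p using Polynomial.induction_on' with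
  | add p r hp hr => simp only [map_add, eval_add]; linear_combination hp + hr
  | monomial n c =>
    have h := (monomialPair_eval hq hw n).1
    rw [← C_mul_X_pow_eq_monomial, ← smul_eq_C_mul, map_smul, Dq_X_pow]
    simp only [eval_smul, smul_eq_mul, eval_pow, eval_X]
    linear_combination c * h

/-- `S_q p (x(s)) = (p(x(s+1/2)) + p(x(s-1/2))) / 2`, with `w = q^s`. -/
theorem eval_Sq {q : ℝ} (hq : 0 < q) {w : ℂ} (hw : w ≠ 0) (p : ℂ[X]) :
    (Sq q p).eval (lattice w)
      = (p.eval (lattice (w * sqrtQ q)) + p.eval (lattice (w / sqrtQ q))) / 2 := by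
  induction p using Polynomial.induction_on' with
  | add p r hp hr => simp only [map_add, eval_add]; linear_combination hp + hr
  | monomial n c =>
    have h := (monomialPair_eval hq hw n).2
    rw [← C_mul_X_pow_eq_monomial, ← smul_eq_C_mul, map_smul, Sq_X_pow]
    simp only [eval_smul, smul_eq_mul, eval_pow, eval_X]
    linear_combination c * h

/-- Left multiplication of a functional by a polynomial: `⟨φ u, f⟩ = ⟨u, φ f⟩`. -/
def polyMul (φ : ℂ[X]) (u : ℂ[X] →ₗ[ℂ] ℂ) : ℂ[X] →ₗ[ℂ] ℂ :=
  u ∘ₗ LinearMap.mulLeft ℂ φ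

/-- `⟨𝐃_q u, f⟩ = -⟨u, D_q f⟩`. -/
def functionalDq (q : ℝ) (u : ℂ[X] →ₗ[ℂ] ℂ) : ℂ[X] →ₗ[ℂ] ℂ := -(u ∘ₗ Dq q)

/-- `⟨𝐒_q u, f⟩ = ⟨u, S_q f⟩`. -/
def functionalSq (q : ℝ) (u : ℂ[X] →ₗ[ℂ] ℂ) : ℂ[X] →ₗ[ℂ] ℂ := u ∘ₗ Sq q

/-- `P` is a monic orthogonal polynomial sequence with respect to the functional `u`. -/
structure IsMonicOPS (u : ℂ[X] →ₗ[ℂ] ℂ) (P : ℕ → ℂ[X]) : Prop where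
  monic : ∀ n, (P n).Monic
  natDegree : ∀ n, (P n).natDegree = n
  orthogonal : ∀ n m, n ≠ m → u (P n * P m) = 0
  norm_ne_zero : ∀ n, u (P n * P n) ≠ 0

/-- The coefficient `B_n` of `P_{n+1} = (z - B_n) P_n - C_n P_{n-1}`, as
`⟨u, z P_n²⟩ / ⟨u, P_n²⟩`. -/
def recB (u : ℂ[X] →ₗ[ℂ] ℂ) (P : ℕ → ℂ[X]) (n : ℕ) : ℂ :=
  u (X * (P n * P n)) / u (P n * P n)

/-- The coefficient `C_n` (`n ≥ 1`) of `P_{n+1} = (z - B_n) P_n - C_n P_{n-1}`, as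
`⟨u, P_n²⟩ / ⟨u, P_{n-1}²⟩`. -/
def recC (u : ℂ[X] →ₗ[ℂ] ℂ) (P : ℕ → ℂ[X]) (n : ℕ) : ℂ :=
  u (P n * P n) / u (P (n - 1) * P (n - 1))

/-- `P_{n-1}`, with `P_{-1} = 0`. -/
def prevPoly (P : ℕ → ℂ[X]) : ℕ → ℂ[X]
  | 0 => 0
  | n + 1 => P n

/-- The `q`-shifted factorial `(x; q)_n`. -/
def qPoch (q : ℝ) (x : ℂ) (n : ℕ) : ℂ := ∏ j ∈ Finset.range n, (1 - x * (q : ℂ) ^ j)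

/-- The Askey-Wilson polynomial `p_n(z; t₀, t₁, t₂, t₃ | q)` for `t₀ ≠ 0`:
`t₀⁻ⁿ (t₀t₁, t₀t₂, t₀t₃; q)_n` times the series
`₄φ₃(q⁻ⁿ, t₀t₁t₂t₃ qⁿ⁻¹, t₀ e^{iθ}, t₀ e^{-iθ}; t₀t₁, t₀t₂, t₀t₃; q, q)`, `z = cos θ`.
Here `(x; q)_n / (x; q)_k` is written as `(x qᵏ; q)_{n-k}`, and
`(t₀ e^{iθ}, t₀ e^{-iθ}; q)_k` as `∏_{j < k} (1 - 2 t₀ qʲ z + t₀² q²ʲ)`. -/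
def askeyWilson (q : ℝ) (t : Fin 4 → ℂ) (n : ℕ) : ℂ[X] :=
  C ((t 0 ^ n)⁻¹) * ∑ k ∈ Finset.range (n + 1),
    C (qPoch q ((q : ℂ) ^ (-(n : ℤ))) k
        * qPoch q (t 0 * t 1 * t 2 * t 3 * (q : ℂ) ^ ((n : ℤ) - 1)) k
        / qPoch q (q : ℂ) k * (q : ℂ) ^ k
        * qPoch q (t 0 * t 1 * (q : ℂ) ^ k) (n - k)
        * qPoch q (t 0 * t 2 * (q : ℂ) ^ k) (n - k)
        * qPoch q (t 0 * t 3 * (q : ℂ) ^ k) (n - k))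
      * ∏ j ∈ Finset.range k,
          (1 - C (2 * t 0 * (q : ℂ) ^ j) * X + C (t 0 ^ 2 * (q : ℂ) ^ (2 * j)))

/-- `P_n` is a nonzero multiple of `p_n(·; t | q)` for all `n`, with the same parameters `t`. -/
def IsAskeyWilsonMultiple (q : ℝ) (P : ℕ → ℂ[X]) : Prop :=
  ∃ t : Fin 4 → ℂ, t 0 ≠ 0 ∧ ∀ n, ∃ κ : ℂ, κ ≠ 0 ∧ P n = C κ * askeyWilson q t n

/-- Each `P_n` is the coefficientwise limit, as `t` tends along `l`, of nonzero multiples of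
`p_n(·; t | q)`. -/
def IsAskeyWilsonLimit (q : ℝ) (l : Filter (Fin 4 → ℂ)) (P : ℕ → ℂ[X]) : Prop :=
  ∃ κ : ℕ → (Fin 4 → ℂ) → ℂ, (∀ n t, κ n t ≠ 0) ∧
    ∀ n m, Tendsto (fun t => κ n t * (askeyWilson q t n).coeff m) l (𝓝 ((P n).coeff m))

/-- Multiples of Askey-Wilson polynomials for some values of the parameters, or the limiting
case in which all four parameters tend to `0` (through nonzero values), or a limiting case in
which the parameters with index in a nonempty set `I` tend independently to `∞` and the other
ones keep fixed nonzero values. -/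
def IsAskeyWilsonFamily (q : ℝ) (P : ℕ → ℂ[X]) : Prop :=
  IsAskeyWilsonMultiple q P ∨
  IsAskeyWilsonLimit q (Filter.pi fun _ => 𝓝[≠] (0 : ℂ)) P ∨
  ∃ (I : Set (Fin 4)) (F : Fin 4 → Filter ℂ), I.Nonempty ∧
    (∀ i ∈ I, F i = Bornology.cobounded ℂ) ∧ (∀ i ∉ I, ∃ t : ℂ, t ≠ 0 ∧ F i = pure t) ∧
    IsAskeyWilsonLimit q (Filter.pi F) P

end AskeyWilson

end

/-!
The argument rests on the two product rules `D_q (z f) = S_q f + α z D_q f` and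
`S_q (z f) = (α² - 1)(z² - 1) D_q f + α z S_q f`, from which all identities between the operators
follow by induction, and on the second-order operator `L = φ D_q² + ψ S_q D_q`.

*The Pearson equation.* The polynomials `S_q P_n` form a basis of `ℂ[z]`; let `s_n` be the dual
basis. Then `𝐒_q s_n = P_n u / ⟨u, P_n²⟩`, and the structure relation says that `𝐃_q (π s_n)`,
`π = az² + bz + c`, is a combination of `P_{n-1} u`, `P_n u` and `P_{n+1} u`. By the product rule
the same holds for `π̂ 𝐃_q s_n` with another polynomial `π̂ ≠ 0` of degree at most two. The two
conditions of the theorem are what is needed for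
`P_1 u / ⟨u, P_1²⟩ + 𝐃_q (a C_2 (C_3 / r_3) s_2 + (B_1 - B_0)/2 s_1 + s_0)` to be killed by `π̂`
and to vanish in low degree, hence to be zero (`dualP_one_eq`). Applying `𝐒_q` gives
`𝐃_q (φ u) = 𝐒_q (ψ u)` (`pearson_of_structure`).

*The difference equation.* The Pearson equation makes `L` symmetric for `⟨u, f g⟩`
(`apply_mul_secondOrder_comm`). Since `L` does not raise degrees, the `P_n` are eigenfunctions
(`IsMonicOPS.secondOrder_eq`). Regularity of `u` also forces the eigenvalues to be distinct
(`IsMonicOPS.leading_ne_zero`).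

*Askey-Wilson polynomials.* With `x = (w + 1/w)/2`, the pair `(φ, ψ)` is equivalent to the quartic
`H(w) = w² (2 φ(x) + ψ(x) (q^{1/2} - q^{-1/2}) (w - 1/w)/2)`. When `H` is a multiple of
`∏ (1 - t_i w)`, the operator is bidiagonal in the basis `(t_0 w, t_0 / w; q)_k`, and its
eigenfunctions are the Askey-Wilson polynomials (`awOp_askeyWilson`). A quartic with `H(0) ≠ 0` has
this form; the `t_i` may all be zero, and then one lets them tend to `0`. If `H(0) = 0`, then `H`
has degree four, and its roots at `0` are limits of `1 / t_i` with `t_i → ∞`. Because the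
eigenvalues are distinct, monic eigenfunctions depend continuously on `H`
(`tendsto_coeff_eigenfunction`), and this gives the limits
(`isAskeyWilsonFamily_of_eigenfunctions`).
-/

noncomputable section

namespace AskeyWilson

/-! ### The product rules -/

theorem Dq_one (q : ℝ) : Dq q 1 = 0 := by
  simpa [monomialPair] using Dq_X_pow q 0

theorem Sq_one (q : ℝ) : Sq q 1 = 1 := by
  simpa [monomialPair] using Sq_X_pow q 0

theorem Dq_C_mul (q : ℝ) (c : ℂ) (f : ℂ[X]) : Dq q (C c * f) = C c * Dq q f := by
  rw [← smul_eq_C_mul, map_smul, smul_eq_C_mul]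

theorem Sq_C_mul (q : ℝ) (c : ℂ) (f : ℂ[X]) : Sq q (C c * f) = C c * Sq q f := by
  rw [← smul_eq_C_mul, map_smul, smul_eq_C_mul]

theorem Dq_C (q : ℝ) (c : ℂ) : Dq q (C c) = 0 := by
  have := Dq_C_mul q c 1
  simpa [Dq_one] using this

theorem Sq_C (q : ℝ) (c : ℂ) : Sq q (C c) = C c := by
  have := Sq_C_mul q c 1
  simpa [Sq_one] using this

theorem Dq_X_mul (q : ℝ) (f : ℂ[X]) :
    Dq q (X * f) = Sq q f + C (alpha q 1) * X * Dq q f := by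
  induction f using Polynomial.induction_on' with
  | add f g hf hg => simp only [mul_add, map_add, hf, hg]; ring
  | monomial n c =>
    rw [← C_mul_X_pow_eq_monomial, mul_left_comm, ← pow_succ', Dq_C_mul, Dq_C_mul, Sq_C_mul,
      Dq_X_pow, Dq_X_pow, Sq_X_pow, monomialPair]
    ring

theorem Sq_X_mul (q : ℝ) (f : ℂ[X]) :
    Sq q (X * f) = C (alpha q 1 ^ 2 - 1) * (X ^ 2 - 1) * Dq q f + C (alpha q 1) * X * Sq q f := by
  induction f using Polynomial.induction_on' with
  | add f g hf hg => simp only [mul_add, map_add, hf, hg]; ring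
  | monomial n c =>
    rw [← C_mul_X_pow_eq_monomial, mul_left_comm, ← pow_succ', Sq_C_mul, Dq_C_mul, Sq_C_mul,
      Sq_X_pow, Dq_X_pow, Sq_X_pow, monomialPair]
    ring

theorem Dq_X (q : ℝ) : Dq q X = 1 := by
  have := Dq_X_mul q 1
  simpa [Dq_one, Sq_one] using this

theorem Sq_X (q : ℝ) : Sq q X = C (alpha q 1) * X := by
  have := Sq_X_mul q 1
  simpa [Dq_one, Sq_one] using this

/-- Induction for statements that are linear in a polynomial. -/
theorem induction_X_mul {M : ℂ[X] → Prop} (h1 : M 1) (hadd : ∀ f g, M f → M g → M (f + g))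
    (hC : ∀ c f, M f → M (C c * f)) (hX : ∀ f, M f → M (X * f)) (f : ℂ[X]) : M f := by
  induction f using Polynomial.induction_on' with
  | add f g hf hg => exact hadd f g hf hg
  | monomial n c =>
    rw [← C_mul_X_pow_eq_monomial]
    refine hC _ _ ?_
    induction n with
    | zero => simpa using h1
    | succ n ih => rw [pow_succ']; exact hX _ ih

/-- The two commutation rules between the divided difference and the average; they have to be
proved together. -/
theorem Dq_Sq_and_Sq_Sq (q : ℝ) (f : ℂ[X]) :
    Dq q (Sq q f) = C (alpha q 1) * Sq q (Dq q f)
        + C (alpha q 1 ^ 2 - 1) * X * Dq q (Dq q f) ∧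
      Sq q (Sq q f) = C (alpha q 1) * (C (alpha q 1 ^ 2 - 1) * (X ^ 2 - 1)) * Dq q (Dq q f)
        + C (alpha q 1 ^ 2 - 1) * X * Sq q (Dq q f) + f := by
  induction f using induction_X_mul with
  | h1 => simp [Dq_one, Sq_one]
  | hadd f g hf hg =>
    simp only [map_add, hf.1, hf.2, hg.1, hg.2]
    constructor <;> ring
  | hC c f hf =>
    simp only [Dq_C_mul, Sq_C_mul, hf.1, hf.2]
    constructor <;> ring
  | hX f hf =>
    simp only [Dq_X_mul, Sq_X_mul, map_add, mul_assoc, Dq_C_mul, Sq_C_mul, hf.1, hf.2, sub_mul,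
      pow_two, one_mul, map_sub]
    simp only [map_mul, map_one]
    constructor <;> ring

theorem Dq_Sq (q : ℝ) (f : ℂ[X]) :
    Dq q (Sq q f) = C (alpha q 1) * Sq q (Dq q f)
        + C (alpha q 1 ^ 2 - 1) * X * Dq q (Dq q f) :=
  (Dq_Sq_and_Sq_Sq q f).1

/-! ### Pearson operators -/

/-- The operator `f ↦ φ D_q f + ψ S_q f`. The functional `u` satisfies
`𝐃_q (φ u) = 𝐒_q (ψ u)` exactly when it vanishes on the range of this operator. -/
def pearsonOp (q : ℝ) (φ ψ : ℂ[X]) (f : ℂ[X]) : ℂ[X] := φ * Dq q f + ψ * Sq q f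

/-- The companion of `pearsonOp` that appears when `pearsonOp` is applied to `X * f`. -/
def pearsonOp' (q : ℝ) (φ ψ : ℂ[X]) (f : ℂ[X]) : ℂ[X] :=
  φ * Sq q f + ψ * (C (alpha q 1 ^ 2 - 1) * (X ^ 2 - 1)) * Dq q f

theorem pearsonOp_X_mul (q : ℝ) (φ ψ f : ℂ[X]) :
    pearsonOp q φ ψ (X * f)
      = C (alpha q 1) * X * pearsonOp q φ ψ f + pearsonOp' q φ ψ f := by
  simp only [pearsonOp, pearsonOp', Dq_X_mul, Sq_X_mul]; ring

theorem pearsonOp'_X_mul (q : ℝ) (φ ψ f : ℂ[X]) :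
    pearsonOp' q φ ψ (X * f) = C (alpha q 1) * X * pearsonOp' q φ ψ f
      + C (alpha q 1 ^ 2 - 1) * (X ^ 2 - 1) * pearsonOp q φ ψ f := by
  simp only [pearsonOp, pearsonOp', Dq_X_mul, Sq_X_mul]; ring

theorem pearsonOp_add (q : ℝ) (φ ψ f g : ℂ[X]) :
    pearsonOp q φ ψ (f + g) = pearsonOp q φ ψ f + pearsonOp q φ ψ g := by
  simp only [pearsonOp, map_add]; ring

theorem pearsonOp_sub (q : ℝ) (φ ψ f g : ℂ[X]) :
    pearsonOp q φ ψ (f - g) = pearsonOp q φ ψ f - pearsonOp q φ ψ g := by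
  simp only [pearsonOp, map_sub]; ring

theorem pearsonOp_C_mul (q : ℝ) (φ ψ : ℂ[X]) (c : ℂ) (f : ℂ[X]) :
    pearsonOp q φ ψ (C c * f) = C c * pearsonOp q φ ψ f := by
  simp only [pearsonOp, Dq_C_mul, Sq_C_mul]; ring

/-- Multiplication by `g` can be moved inside a Pearson operator. On the lattice this is
`g(x) = (S_q g)(x(s ± 1/2)) - (α x(s ± 1/2) - x(s)) (D_q g)(x(s ± 1/2))`. -/
theorem mul_pearsonOp (q : ℝ) (φ ψ F g : ℂ[X]) :
    g * pearsonOp q φ ψ F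
      = pearsonOp q φ ψ (F * Sq q g) - C (alpha q 1) * pearsonOp q φ ψ (X * (F * Dq q g))
        + X * pearsonOp q φ ψ (F * Dq q g) := by
  induction g using induction_X_mul with
  | h1 => simp [Dq_one, Sq_one, pearsonOp]
  | hadd f g hf hg =>
    simp only [map_add, mul_add, add_mul, pearsonOp_add, hf, hg]; ring
  | hC c f hf =>
    simp only [Dq_C_mul, Sq_C_mul, mul_left_comm _ (C c), pearsonOp_C_mul, mul_assoc, hf]
    ring
  | hX f hf =>
    have e1 : F * Sq q (X * f) = C (alpha q 1 ^ 2 - 1) * (X * (X * (F * Dq q f)))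
        - C (alpha q 1 ^ 2 - 1) * (F * Dq q f) + C (alpha q 1) * (X * (F * Sq q f)) := by
      rw [Sq_X_mul]; ring
    have e2 : F * Dq q (X * f) = F * Sq q f + C (alpha q 1) * (X * (F * Dq q f)) := by
      rw [Dq_X_mul]; ring
    rw [mul_assoc, hf, e1, e2]
    simp only [mul_add, pearsonOp_add, pearsonOp_sub, pearsonOp_C_mul, mul_left_comm _ (C _),
      pearsonOp_X_mul, pearsonOp'_X_mul]
    simp only [map_sub, map_pow, map_one]
    ring

/-! ### The numbers `α_n` and `γ_n` -/

theorem sqrtQ_sq {q : ℝ} (hq : 0 < q) : sqrtQ q ^ 2 = (q : ℂ) := by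
  rw [sqrtQ, ← Complex.ofReal_pow, ← Real.rpow_natCast, ← Real.rpow_mul hq.le]
  norm_num

theorem ofReal_rpow_half {q : ℝ} (hq : 0 < q) (n : ℤ) :
    ((q ^ ((n : ℝ) / 2) : ℝ) : ℂ) = sqrtQ q ^ n := by
  rw [sqrtQ, ← Complex.ofReal_zpow, ← Real.rpow_intCast, ← Real.rpow_mul hq.le]
  congr 2; ring

theorem alpha_eq {q : ℝ} (hq : 0 < q) (n : ℤ) :
    alpha q n = (sqrtQ q ^ n + (sqrtQ q ^ n)⁻¹) / 2 := by
  rw [← ofReal_rpow_half hq, alpha, Real.rpow_neg hq.le]; push_cast; rfl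

theorem gamma_eq {q : ℝ} (hq : 0 < q) (n : ℤ) :
    gamma q n = (sqrtQ q ^ n - (sqrtQ q ^ n)⁻¹) / (sqrtQ q - (sqrtQ q)⁻¹) := by
  rw [← ofReal_rpow_half hq, gamma, Real.rpow_neg hq.le, Real.rpow_neg hq.le, sqrtQ]
  push_cast; rfl

theorem sqrtQ_pow_ne_one {q : ℝ} (hq0 : 0 < q) (hq1 : q < 1) {n : ℕ} (hn : n ≠ 0) :
    sqrtQ q ^ n ≠ 1 := by
  have h0 : 0 < q ^ ((1 : ℝ) / 2) := Real.rpow_pos_of_pos hq0 _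
  have h1 : q ^ ((1 : ℝ) / 2) < 1 := Real.rpow_lt_one hq0.le hq1 (by norm_num)
  have := pow_lt_one₀ h0.le h1 hn
  rw [sqrtQ]
  exact_mod_cast this.ne

theorem q_pow_ne_one {q : ℝ} (hq0 : 0 < q) (hq1 : q < 1) {n : ℕ} (hn : n ≠ 0) :
    (q : ℂ) ^ n ≠ 1 := by
  rw [← sqrtQ_sq hq0, ← pow_mul]
  exact sqrtQ_pow_ne_one hq0 hq1 (by omega)

theorem sqrtQ_sub_inv_ne_zero {q : ℝ} (hq0 : 0 < q) (hq1 : q < 1) :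
    sqrtQ q - (sqrtQ q)⁻¹ ≠ 0 := by
  have hs := sqrtQ_ne_zero hq0
  intro h
  apply sqrtQ_pow_ne_one hq0 hq1 (n := 2) (by norm_num)
  field_simp at h
  linear_combination h

theorem gamma_ne_zero {q : ℝ} (hq0 : 0 < q) (hq1 : q < 1) {n : ℕ} (hn : n ≠ 0) :
    gamma q n ≠ 0 := by
  have hs := pow_ne_zero n (sqrtQ_ne_zero hq0)
  rw [gamma_eq hq0, zpow_natCast]
  refine div_ne_zero (fun h => ?_) (sqrtQ_sub_inv_ne_zero hq0 hq1)
  apply sqrtQ_pow_ne_one hq0 hq1 (n := n * 2) (by omega)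
  field_simp at h
  rw [pow_mul]
  linear_combination h

theorem alpha_ne_zero {q : ℝ} (hq : 0 < q) (n : ℤ) : alpha q n ≠ 0 := by
  rw [alpha, Complex.ofReal_ne_zero]
  have h1 := Real.rpow_pos_of_pos hq ((n : ℝ) / 2)
  have h2 := Real.rpow_pos_of_pos hq (-((n : ℝ) / 2))
  positivity

theorem alpha_zero {q : ℝ} (hq : 0 < q) : alpha q 0 = 1 := by
  rw [alpha_eq hq]; norm_num

theorem gamma_zero {q : ℝ} (hq : 0 < q) : gamma q 0 = 0 := by
  rw [gamma_eq hq]; norm_num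

theorem gamma_one {q : ℝ} (hq0 : 0 < q) (hq1 : q < 1) : gamma q 1 = 1 := by
  rw [gamma_eq hq0, zpow_one, div_self (sqrtQ_sub_inv_ne_zero hq0 hq1)]

theorem gamma_succ {q : ℝ} (hq0 : 0 < q) (hq1 : q < 1) (n : ℤ) :
    gamma q (n + 1) = alpha q n + alpha q 1 * gamma q n := by
  have h1 := sqrtQ_ne_zero hq0
  have h2 := sqrtQ_sub_inv_ne_zero hq0 hq1
  rw [gamma_eq hq0, gamma_eq hq0, alpha_eq hq0, alpha_one hq0, zpow_add_one₀ h1]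
  have h3 : sqrtQ q ^ n ≠ 0 := zpow_ne_zero _ h1
  generalize sqrtQ q ^ n = x at *
  rw [div_eq_iff h2, add_mul, mul_assoc, div_mul_cancel₀ _ h2]
  field_simp; ring

theorem alpha_succ {q : ℝ} (hq0 : 0 < q) (hq1 : q < 1) (n : ℤ) :
    alpha q (n + 1) = (alpha q 1 ^ 2 - 1) * gamma q n + alpha q 1 * alpha q n := by
  have h1 := sqrtQ_ne_zero hq0
  have h2 := sqrtQ_sub_inv_ne_zero hq0 hq1
  have h3 : sqrtQ q ^ n ≠ 0 := zpow_ne_zero _ h1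
  have h4 : alpha q 1 ^ 2 - 1 = (sqrtQ q - (sqrtQ q)⁻¹) * ((sqrtQ q - (sqrtQ q)⁻¹) / 4) := by
    rw [alpha_one hq0]; field_simp; ring
  rw [h4, gamma_eq hq0, alpha_one hq0, alpha_eq hq0, alpha_eq hq0, zpow_add_one₀ h1]
  generalize sqrtQ q ^ n = x at *
  rw [mul_right_comm, mul_div_cancel₀ _ h2]
  field_simp; ring

/-! ### Leading coefficients -/

/-- A linear operator on polynomials that maps `X ^ n` to `r n * X ^ n` plus terms of lower
degree. -/
structure IsTriangular (T : ℂ[X] →ₗ[ℂ] ℂ[X]) (r : ℕ → ℂ) : Prop where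
  natDegree_le : ∀ n, (T (X ^ n)).natDegree ≤ n
  coeff_eq : ∀ n, (T (X ^ n)).coeff n = r n

theorem map_eq_sum (T : ℂ[X] →ₗ[ℂ] ℂ[X]) {f : ℂ[X]} {n : ℕ} (hf : f.natDegree ≤ n) :
    T f = ∑ k ∈ Finset.range (n + 1), C (f.coeff k) * T (X ^ k) := by
  conv_lhs => rw [f.as_sum_range_C_mul_X_pow' (n := n + 1) (by omega)]
  rw [map_sum]
  refine Finset.sum_congr rfl fun k _ => ?_
  rw [← smul_eq_C_mul, map_smul, smul_eq_C_mul]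

namespace IsTriangular

variable {T : ℂ[X] →ₗ[ℂ] ℂ[X]} {r : ℕ → ℂ}

theorem natDegree_map_le (hT : IsTriangular T r) {f : ℂ[X]} {n : ℕ} (hf : f.natDegree ≤ n) :
    (T f).natDegree ≤ n := by
  rw [map_eq_sum T hf]
  refine natDegree_sum_le_of_forall_le _ _ fun k hk => ?_
  exact (natDegree_C_mul_le _ _).trans
    ((hT.natDegree_le k).trans (by simpa [Nat.lt_succ_iff] using hk))

theorem coeff_map (hT : IsTriangular T r) {f : ℂ[X]} {n : ℕ} (hf : f.natDegree ≤ n) :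
    (T f).coeff n = r n * f.coeff n := by
  rw [map_eq_sum T hf, finsetSum_coeff, Finset.sum_range_succ, coeff_C_mul, hT.coeff_eq,
    Finset.sum_eq_zero, zero_add, mul_comm]
  intro k hk
  rw [coeff_C_mul, coeff_eq_zero_of_natDegree_lt (p := T (X ^ k)), mul_zero]
  exact (hT.natDegree_le k).trans_lt (by simpa using hk)

theorem injective (hT : IsTriangular T r) (hr : ∀ n, r n ≠ 0) : Function.Injective T := by
  rw [injective_iff_map_eq_zero]
  intro f hf
  by_contra h
  have h1 := hT.coeff_map (le_refl f.natDegree)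
  rw [hf, coeff_zero, coeff_natDegree] at h1
  exact mul_ne_zero (hr _) (leadingCoeff_ne_zero.mpr h) h1.symm

theorem surjective (hT : IsTriangular T r) (hr : ∀ n, r n ≠ 0) : Function.Surjective T := by
  have key : ∀ n (g : ℂ[X]), g.natDegree < n → ∃ f, T f = g := by
    intro n
    induction n with
    | zero => intro g hg; omega
    | succ n ih =>
      intro g hg
      set c := g.coeff n / r n
      have hd : (g - C c * T (X ^ n)).natDegree ≤ n :=
        (natDegree_sub_le _ _).trans (max_le (Nat.lt_succ_iff.mp hg)
          ((natDegree_C_mul_le _ _).trans (hT.natDegree_le n)))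
      have hc : (g - C c * T (X ^ n)).coeff n = 0 := by
        rw [coeff_sub, coeff_C_mul, hT.coeff_eq, div_mul_cancel₀ _ (hr n), sub_self]
      have : ∃ f, T f = g - C c * T (X ^ n) := by
        rcases Nat.eq_zero_or_pos n with rfl | hn
        · refine ⟨0, ?_⟩
          rw [map_zero, eq_C_of_natDegree_le_zero hd, hc, C_0]
        · refine ih _ (lt_of_le_of_ne hd fun h => ?_)
          have h0 : g - C c * T (X ^ n) = 0 := by
            rw [← leadingCoeff_eq_zero, leadingCoeff, h, hc]
          rw [h0, natDegree_zero] at h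
          omega
      obtain ⟨f, hf⟩ := this
      refine ⟨f + C c * X ^ n, ?_⟩
      rw [map_add, hf, ← smul_eq_C_mul, ← smul_eq_C_mul, map_smul, sub_add_cancel]
  exact fun g => key (g.natDegree + 1) g (Nat.lt_succ_self _)

end IsTriangular

theorem monomialPair_coeff {q : ℝ} (hq0 : 0 < q) (hq1 : q < 1) (n : ℕ) :
    ((X * Dq q (X ^ n)).natDegree ≤ n ∧ (X * Dq q (X ^ n)).coeff n = gamma q n) ∧
      (Sq q (X ^ n)).natDegree ≤ n ∧ (Sq q (X ^ n)).coeff n = alpha q n := by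
  induction n with
  | zero => simp [Dq_one, Sq_one, gamma_zero hq0, alpha_zero hq0]
  | succ n ih =>
    obtain ⟨⟨h1, h2⟩, h3, h4⟩ := ih
    have hU : C (alpha q 1 ^ 2 - 1) * (X ^ 2 - 1) * Dq q (X ^ n)
        = C (alpha q 1 ^ 2 - 1) * (X * (X * Dq q (X ^ n)) - Dq q (X ^ n)) := by ring
    have hD : (Dq q (X ^ n)).natDegree ≤ n := by
      by_cases h : Dq q (X ^ n) = 0
      · simp [h]
      · rw [natDegree_X_mul h] at h1; omega
    have hm : ∀ f : ℂ[X], f.natDegree ≤ n → (X * f).natDegree ≤ n + 1 := fun f hf =>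
      natDegree_mul_le.trans (by rw [natDegree_X]; omega)
    rw [pow_succ', Dq_X_mul, Sq_X_mul, hU, mul_assoc]
    refine ⟨⟨hm _ (natDegree_add_le_of_degree_le h3 ((natDegree_C_mul_le _ _).trans h1)), ?_⟩,
      natDegree_add_le_of_degree_le ((natDegree_C_mul_le _ _).trans
        ((natDegree_sub_le _ _).trans (max_le (hm _ h1) (by omega)))) ?_, ?_⟩
    · rw [coeff_X_mul, coeff_add, coeff_C_mul, h2, h4]; push_cast
      rw [gamma_succ hq0 hq1]
    · rw [mul_assoc]; exact (natDegree_C_mul_le _ _).trans (hm _ h3)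
    · rw [coeff_add, coeff_C_mul, coeff_sub, coeff_X_mul, mul_assoc, coeff_C_mul, coeff_X_mul, h2,
        h4, coeff_eq_zero_of_natDegree_lt (by omega : (Dq q (X ^ n)).natDegree < n + 1)]
      push_cast
      rw [alpha_succ hq0 hq1, sub_zero]

theorem isTriangular_Sq {q : ℝ} (hq0 : 0 < q) (hq1 : q < 1) :
    IsTriangular (Sq q) fun n => alpha q n :=
  ⟨fun n => (monomialPair_coeff hq0 hq1 n).2.1, fun n => (monomialPair_coeff hq0 hq1 n).2.2⟩

theorem isTriangular_X_mul_Dq {q : ℝ} (hq0 : 0 < q) (hq1 : q < 1) :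
    IsTriangular (LinearMap.mulLeft ℂ X ∘ₗ Dq q) fun n => gamma q n :=
  ⟨fun n => (monomialPair_coeff hq0 hq1 n).1.1, fun n => (monomialPair_coeff hq0 hq1 n).1.2⟩

theorem natDegree_Dq_le {q : ℝ} (hq0 : 0 < q) (hq1 : q < 1) {f : ℂ[X]} {n : ℕ}
    (hf : f.natDegree ≤ n + 1) : (Dq q f).natDegree ≤ n := by
  have h1 := (isTriangular_X_mul_Dq hq0 hq1).natDegree_map_le hf
  simp only [LinearMap.comp_apply, LinearMap.mulLeft_apply] at h1
  by_cases h : Dq q f = 0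
  · simp [h]
  · rw [natDegree_X_mul h] at h1; omega

theorem coeff_Dq {q : ℝ} (hq0 : 0 < q) (hq1 : q < 1) {f : ℂ[X]} {n : ℕ}
    (hf : f.natDegree ≤ n + 1) : (Dq q f).coeff n = gamma q (n + 1 : ℕ) * f.coeff (n + 1) := by
  have h1 := (isTriangular_X_mul_Dq hq0 hq1).coeff_map hf
  simpa only [LinearMap.comp_apply, LinearMap.mulLeft_apply, coeff_X_mul] using h1

theorem Dq_surjective {q : ℝ} (hq0 : 0 < q) (hq1 : q < 1) : Function.Surjective (Dq q) := by
  have h : IsTriangular (Dq q ∘ₗ LinearMap.mulLeft ℂ X) fun n => gamma q (n + 1 : ℕ) := by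
    refine ⟨fun n => ?_, fun n => ?_⟩
    · simpa [← pow_succ'] using natDegree_Dq_le hq0 hq1 (natDegree_X_pow_le (R := ℂ) (n + 1))
    · simpa [← pow_succ'] using coeff_Dq hq0 hq1 (natDegree_X_pow_le (R := ℂ) (n + 1))
  intro g
  obtain ⟨f, hf⟩ := h.surjective (fun n => gamma_ne_zero hq0 hq1 n.succ_ne_zero) g
  exact ⟨X * f, by rwa [LinearMap.comp_apply, LinearMap.mulLeft_apply] at hf⟩

theorem Sq_bijective {q : ℝ} (hq0 : 0 < q) (hq1 : q < 1) : Function.Bijective (Sq q) :=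
  ⟨(isTriangular_Sq hq0 hq1).injective fun n => alpha_ne_zero hq0 n,
    (isTriangular_Sq hq0 hq1).surjective fun n => alpha_ne_zero hq0 n⟩

/-! ### Monic orthogonal polynomial sequences -/

/-- Two linear maps on polynomials agree when they agree on a monic sequence containing one
polynomial of each degree. -/
theorem ext_of_monic {M : Type*} [AddCommGroup M] [Module ℂ M] {P : ℕ → ℂ[X]}
    (hm : ∀ n, (P n).Monic) (hd : ∀ n, (P n).natDegree = n) {v w : ℂ[X] →ₗ[ℂ] M}
    (h : ∀ n, v (P n) = w (P n)) : v = w := by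
  have key : ∀ n (f : ℂ[X]), f.natDegree < n → v f = w f := by
    intro n
    induction n with
    | zero => intro f hf; omega
    | succ n ih =>
      intro f hf
      set c := f.coeff n
      have hc : (f - c • P n).coeff n = 0 := by
        have : (P n).coeff n = 1 := by
          have := (hm n).coeff_natDegree
          rwa [hd n] at this
        rw [coeff_sub, coeff_smul, this, smul_eq_mul, mul_one, sub_self]
      have hle : (f - c • P n).natDegree ≤ n :=
        (natDegree_sub_le _ _).trans (max_le (Nat.lt_succ_iff.mp hf)
          ((natDegree_smul_le _ _).trans (hd n).le))
      have h0 : v (f - c • P n) = w (f - c • P n) := by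
        by_cases h0 : f - c • P n = 0
        · rw [h0, map_zero, map_zero]
        · refine ih _ (lt_of_le_of_ne hle fun h1 => h0 ?_)
          rw [← leadingCoeff_eq_zero, leadingCoeff, h1, hc]
      rw [map_sub, map_sub, map_smul, map_smul, h n] at h0
      exact sub_left_injective h0
  exact LinearMap.ext fun f => key _ f (Nat.lt_succ_self _)

namespace IsMonicOPS

variable {u : ℂ[X] →ₗ[ℂ] ℂ} {P : ℕ → ℂ[X]}

theorem coeff_self (hP : IsMonicOPS u P) (n : ℕ) : (P n).coeff n = 1 := by
  have := (hP.monic n).coeff_natDegree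
  rwa [hP.natDegree n] at this

theorem apply_zero (hP : IsMonicOPS u P) : P 0 = 1 :=
  (hP.monic 0).natDegree_eq_zero.mp (hP.natDegree 0)

theorem apply_mul_eq (hP : IsMonicOPS u P) (n : ℕ) {f : ℂ[X]} (hf : f.natDegree ≤ n) :
    u (P n * f) = f.coeff n * u (P n * P n) := by
  have key : ∀ k, k ≤ n → ∀ (g : ℂ[X]), g.natDegree < k → u (P n * g) = 0 := by
    intro k
    induction k with
    | zero => intro _ g hg; omega
    | succ k ih =>
      intro hk g hg
      have hle : (g - g.coeff k • P k).natDegree ≤ k :=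
        (natDegree_sub_le _ _).trans (max_le (Nat.lt_succ_iff.mp hg)
          ((natDegree_smul_le _ _).trans (hP.natDegree k).le))
      have h0 : u (P n * (g - g.coeff k • P k)) = 0 := by
        by_cases h0 : g - g.coeff k • P k = 0
        · rw [h0, mul_zero, map_zero]
        · refine ih (by omega) _ (lt_of_le_of_ne hle fun h1 => h0 ?_)
          rw [← leadingCoeff_eq_zero, leadingCoeff, h1, coeff_sub, coeff_smul, hP.coeff_self,
            smul_eq_mul, mul_one, sub_self]
      rw [mul_sub, mul_smul_comm, map_sub, map_smul, hP.orthogonal n k (by omega), smul_zero,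
        sub_zero] at h0
      exact h0
  have hle : (f - f.coeff n • P n).natDegree ≤ n :=
    (natDegree_sub_le _ _).trans (max_le hf ((natDegree_smul_le _ _).trans (hP.natDegree n).le))
  have h0 : u (P n * (f - f.coeff n • P n)) = 0 := by
    by_cases h0 : f - f.coeff n • P n = 0
    · rw [h0, mul_zero, map_zero]
    · refine key n le_rfl _ (lt_of_le_of_ne hle fun h1 => h0 ?_)
      rw [← leadingCoeff_eq_zero, leadingCoeff, h1, coeff_sub, coeff_smul, hP.coeff_self,
        smul_eq_mul, mul_one, sub_self]
  rw [mul_sub, mul_smul_comm, map_sub, map_smul, sub_eq_zero, smul_eq_mul] at h0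
  exact h0

theorem apply_mul_eq_zero (hP : IsMonicOPS u P) {n : ℕ} {f : ℂ[X]} (hf : f.natDegree < n) :
    u (P n * f) = 0 := by
  rw [hP.apply_mul_eq n hf.le, coeff_eq_zero_of_natDegree_lt hf, zero_mul]

theorem eq_zero_of_forall_P (hP : IsMonicOPS u P) {g : ℂ[X]} (h : ∀ n, u (P n * g) = 0) :
    g = 0 := by
  have h1 := h g.natDegree
  rw [hP.apply_mul_eq _ le_rfl] at h1
  exact leadingCoeff_eq_zero.mp ((mul_eq_zero.mp h1).resolve_right (hP.norm_ne_zero _))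

/-- A functional with a monic orthogonal polynomial sequence is not annihilated by a nonzero
polynomial. -/
theorem eq_zero_of_forall (hP : IsMonicOPS u P) {g : ℂ[X]} (h : ∀ f, u (f * g) = 0) : g = 0 :=
  hP.eq_zero_of_forall_P fun n => h (P n)

theorem apply_X_mul_succ (hP : IsMonicOPS u P) (n : ℕ) :
    u (P (n + 1) * (X * P n)) = u (P (n + 1) * P (n + 1)) := by
  rw [hP.apply_mul_eq, coeff_X_mul, hP.coeff_self, one_mul]
  exact natDegree_mul_le.trans (by rw [natDegree_X, hP.natDegree]; omega)

theorem recC_succ_mul (hP : IsMonicOPS u P) (n : ℕ) :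
    recC u P (n + 1) * u (P n * P n) = u (P (n + 1) * P (n + 1)) := by
  rw [recC, Nat.add_sub_cancel, div_mul_cancel₀ _ (hP.norm_ne_zero n)]

theorem recC_succ_ne_zero (hP : IsMonicOPS u P) (n : ℕ) : recC u P (n + 1) ≠ 0 :=
  div_ne_zero (hP.norm_ne_zero _) (hP.norm_ne_zero _)

/-- The three-term recurrence. -/
theorem recurrence (hP : IsMonicOPS u P) (n : ℕ) :
    X * P n = P (n + 1) + C (recB u P n) * P n + C (recC u P n) * prevPoly P n := by
  rw [← sub_eq_zero]
  refine hP.eq_zero_of_forall_P fun m => ?_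
  have hX : ∀ k, (X * P k).natDegree ≤ k + 1 := fun k =>
    natDegree_mul_le.trans (by rw [natDegree_X, hP.natDegree]; omega)
  have hB : recB u P n * u (P n * P n) = u (X * (P n * P n)) :=
    div_mul_cancel₀ _ (hP.norm_ne_zero n)
  simp only [mul_sub, mul_add, map_sub, map_add, ← smul_eq_C_mul, mul_smul_comm, map_smul,
    smul_eq_mul]
  rcases lt_trichotomy m n with h | h | h
  · obtain ⟨n, rfl⟩ : ∃ k, n = k + 1 := ⟨n - 1, by omega⟩
    rw [prevPoly, hP.orthogonal m (n + 1 + 1) (by omega), hP.orthogonal m (n + 1) (by omega)]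
    rcases Nat.lt_or_ge m n with h1 | h1
    · rw [hP.orthogonal m n (by omega), mul_left_comm, ← mul_assoc, mul_comm,
        hP.apply_mul_eq_zero (lt_of_le_of_lt (hX m) (by omega))]
      ring
    · obtain rfl : m = n := by omega
      rw [hP.recC_succ_mul, show P m * (X * P (m + 1)) = P (m + 1) * (X * P m) by ring,
        hP.apply_X_mul_succ]
      ring
  · subst h
    have h1 : u (P m * prevPoly P m) = 0 := by
      cases m with
      | zero => simp [prevPoly]
      | succ m => exact hP.orthogonal _ _ (by omega)
    rw [hP.orthogonal m (m + 1) (by omega), h1, hB, mul_left_comm]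
    ring
  · have h1 : u (P m * prevPoly P n) = 0 := by
      cases n with
      | zero => simp [prevPoly]
      | succ n => exact hP.orthogonal _ _ (by omega)
    rw [h1, hP.orthogonal m n (by omega)]
    rcases Nat.lt_or_ge (n + 1) m with h2 | h2
    · rw [hP.orthogonal m (n + 1) (by omega), hP.apply_mul_eq_zero (lt_of_le_of_lt (hX n) h2)]
      ring
    · obtain rfl : m = n + 1 := by omega
      rw [hP.apply_X_mul_succ]
      ring

end IsMonicOPS

/-! ### The second-order operator is symmetric -/

/-- `pearsonOp` raises degrees by at most one; the factor in front of `f.coeff n` is the one that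
has to be nonzero for the eigenvalues of the second-order operator to be distinct. -/
theorem pearsonOp_natDegree_and_coeff {q : ℝ} (hq0 : 0 < q) (hq1 : q < 1) {φ ψ : ℂ[X]}
    (hφ : φ.natDegree ≤ 2) (hψ : ψ.natDegree ≤ 1) {f : ℂ[X]} {n : ℕ} (hf : f.natDegree ≤ n) :
    (pearsonOp q φ ψ f).natDegree ≤ n + 1 ∧
      (pearsonOp q φ ψ f).coeff (n + 1)
        = (φ.coeff 2 * gamma q n + ψ.coeff 1 * alpha q n) * f.coeff n := by
  have hS := (isTriangular_Sq hq0 hq1).natDegree_map_le hf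
  have hSc := (isTriangular_Sq hq0 hq1).coeff_map hf
  have h2 : (ψ * Sq q f).natDegree ≤ n + 1 := natDegree_mul_le.trans (by omega)
  have h2c : (ψ * Sq q f).coeff (n + 1) = ψ.coeff 1 * (alpha q n * f.coeff n) := by
    rw [add_comm n 1, coeff_mul_add_eq_of_natDegree_le hψ hS, hSc]
  cases n with
  | zero =>
    rw [eq_C_of_natDegree_le_zero hf] at h2 h2c ⊢
    rw [pearsonOp, Dq_C, mul_zero, zero_add]
    refine ⟨h2, ?_⟩
    rw [h2c, Nat.cast_zero, gamma_zero hq0]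
    ring
  | succ n =>
    have hD := natDegree_Dq_le hq0 hq1 hf
    have h1 : (φ * Dq q f).natDegree ≤ n + 1 + 1 := natDegree_mul_le.trans (by omega)
    refine ⟨natDegree_add_le_of_degree_le h1 h2, ?_⟩
    rw [pearsonOp, coeff_add, h2c, show n + 1 + 1 = 2 + n by ring,
      coeff_mul_add_eq_of_natDegree_le hφ hD, coeff_Dq hq0 hq1 hf]
    ring

section Symmetric

variable {q : ℝ} {u : ℂ[X] →ₗ[ℂ] ℂ} {φ ψ : ℂ[X]}

theorem apply_mul_pearsonOp (h : ∀ f, u (pearsonOp q φ ψ f) = 0) (F g : ℂ[X]) :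
    u (g * pearsonOp q φ ψ F) = u (X * pearsonOp q φ ψ (F * Dq q g)) := by
  rw [mul_pearsonOp, map_add, map_sub, ← smul_eq_C_mul, map_smul, h, h, smul_zero, sub_zero,
    zero_add]

/-- The operator `φ D_q² + ψ S_q D_q` is symmetric for the bilinear form `(f, g) ↦ ⟨u, f g⟩`. -/
theorem apply_mul_secondOrder_comm (h : ∀ f, u (pearsonOp q φ ψ f) = 0) (f g : ℂ[X]) :
    u (g * pearsonOp q φ ψ (Dq q f)) = u (f * pearsonOp q φ ψ (Dq q g)) := by
  rw [apply_mul_pearsonOp h (Dq q f) g, apply_mul_pearsonOp h (Dq q g) f, mul_comm (Dq q f)]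

end Symmetric

theorem secondOrder_natDegree_and_coeff {q : ℝ} (hq0 : 0 < q) (hq1 : q < 1) {φ ψ : ℂ[X]}
    (hφ : φ.natDegree ≤ 2) (hψ : ψ.natDegree ≤ 1) {f : ℂ[X]} {n : ℕ} (hf : f.natDegree ≤ n) :
    (pearsonOp q φ ψ (Dq q f)).natDegree ≤ n ∧
      (pearsonOp q φ ψ (Dq q f)).coeff n
        = gamma q n * (φ.coeff 2 * gamma q ((n : ℤ) - 1) + ψ.coeff 1 * alpha q ((n : ℤ) - 1))
          * f.coeff n := by
  cases n with
  | zero =>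
    rw [eq_C_of_natDegree_le_zero hf, Dq_C, Nat.cast_zero, gamma_zero hq0]
    simp [pearsonOp]
  | succ n =>
    obtain ⟨h1, h2⟩ := pearsonOp_natDegree_and_coeff hq0 hq1 hφ hψ (natDegree_Dq_le hq0 hq1 hf)
    refine ⟨h1, ?_⟩
    rw [h2, coeff_Dq hq0 hq1 hf]
    push_cast
    rw [add_sub_cancel_right]
    ring

/-- The second-order operator is symmetric and does not raise degrees, so it is diagonal in an
orthogonal basis. -/
theorem IsMonicOPS.secondOrder_eq {q : ℝ} (hq0 : 0 < q) (hq1 : q < 1)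
    {u : ℂ[X] →ₗ[ℂ] ℂ} {P : ℕ → ℂ[X]} (hP : IsMonicOPS u P) {φ ψ : ℂ[X]}
    (hφ : φ.natDegree ≤ 2) (hψ : ψ.natDegree ≤ 1) (h : ∀ f, u (pearsonOp q φ ψ f) = 0) (n : ℕ) :
    pearsonOp q φ ψ (Dq q (P n))
      = C (gamma q n *
          (φ.coeff 2 * gamma q ((n : ℤ) - 1) + ψ.coeff 1 * alpha q ((n : ℤ) - 1))) * P n := by
  obtain ⟨h1, h2⟩ := secondOrder_natDegree_and_coeff hq0 hq1 hφ hψ (hP.natDegree n).le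
  rw [hP.coeff_self, mul_one] at h2
  rw [← h2, ← sub_eq_zero]
  refine hP.eq_zero_of_forall_P fun m => ?_
  rw [mul_sub, map_sub, mul_left_comm, ← smul_eq_C_mul, map_smul, smul_eq_mul]
  rcases lt_trichotomy m n with hm | rfl | hm
  · obtain ⟨h3, -⟩ := secondOrder_natDegree_and_coeff hq0 hq1 hφ hψ (hP.natDegree m).le
    rw [apply_mul_secondOrder_comm h, hP.apply_mul_eq_zero (h3.trans_lt hm),
      hP.orthogonal m n hm.ne]
    ring
  · rw [hP.apply_mul_eq m h1, sub_self]
  · rw [hP.apply_mul_eq_zero (h1.trans_lt hm), hP.orthogonal m n hm.ne']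
    ring

/-! ### The eigenvalues are distinct -/

/-- The leading coefficient of `pearsonOp` on polynomials of degree `n` does not vanish. If it did,
`P_{n+1}` would have the eigenvalue `0`, and `D_q P_{n+1}` would annihilate the functional for
which the `D_q P_m` are orthogonal. Multiplication by `X` turns this into the vanishing of
`pearsonOp` on all multiples of `D_q P_{n+1}`, which is impossible for degree reasons. -/
theorem IsMonicOPS.leading_ne_zero {q : ℝ} (hq0 : 0 < q) (hq1 : q < 1)
    {u : ℂ[X] →ₗ[ℂ] ℂ} {P : ℕ → ℂ[X]} (hP : IsMonicOPS u P) {φ ψ : ℂ[X]}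
    (hφ : φ.natDegree ≤ 2) (hψ : ψ.natDegree ≤ 1) (hψ1 : ψ.coeff 1 ≠ 0)
    (h : ∀ f, u (pearsonOp q φ ψ f) = 0) (n : ℕ) :
    φ.coeff 2 * gamma q n + ψ.coeff 1 * alpha q n ≠ 0 := by
  intro h0
  set Q := Dq q (P (n + 1)) with hQ
  have hα := alpha_ne_zero hq0 1
  have hQ0 : Q.coeff n ≠ 0 := by
    rw [coeff_Dq hq0 hq1 (hP.natDegree _).le, hP.coeff_self, mul_one]
    exact gamma_ne_zero hq0 hq1 n.succ_ne_zero
  have hQd : Q.natDegree ≤ n := natDegree_Dq_le hq0 hq1 (hP.natDegree _).le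
  -- `P_{n+1}` has the eigenvalue `0`
  have hzero : pearsonOp q φ ψ Q = 0 := by
    rw [hP.secondOrder_eq hq0 hq1 hφ hψ h]
    push_cast
    rw [add_sub_cancel_right, h0]
    simp
  have base : ∀ g, u (X * pearsonOp q φ ψ (Q * g)) = 0 := by
    intro g
    obtain ⟨f, rfl⟩ := Dq_surjective hq0 hq1 g
    rw [← apply_mul_pearsonOp h, hzero, mul_zero, map_zero]
  have hX : ∀ g, Q * (X * g) = X * (Q * g) := fun g => mul_left_comm _ _ _
  -- the relations `u (f * pearsonOp h) = 0` and `u (f * pearsonOp' h) = 0` on the ideal of `Q`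
  have key : ∀ f, (∀ g, u (f * pearsonOp q φ ψ (Q * g)) = 0) ∧
      ∀ g, u (f * pearsonOp' q φ ψ (Q * g)) = 0 := by
    intro f
    induction f using induction_X_mul with
    | h1 =>
      refine ⟨fun g => by rw [one_mul, h], fun g => ?_⟩
      have h1 := h (X * (Q * g))
      rw [pearsonOp_X_mul, map_add, mul_assoc, ← smul_eq_C_mul, map_smul, base] at h1
      rw [one_mul]
      simpa using h1
    | hadd f g hf hg =>
      exact ⟨fun e => by rw [add_mul, map_add, hf.1, hg.1, add_zero],
        fun e => by rw [add_mul, map_add, hf.2, hg.2, add_zero]⟩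
    | hC c f hf =>
      exact ⟨fun e => by rw [mul_assoc, ← smul_eq_C_mul, map_smul, hf.1, smul_zero],
        fun e => by rw [mul_assoc, ← smul_eq_C_mul, map_smul, hf.2, smul_zero]⟩
    | hX f hf =>
      obtain ⟨h1, h2⟩ := hf
      have h3 : ∀ g, u (X * f * pearsonOp q φ ψ (Q * g)) = 0 := by
        intro g
        have e := h1 (X * g)
        rw [hX, pearsonOp_X_mul, mul_add, map_add, h2, add_zero,
          show f * (C (alpha q 1) * X * pearsonOp q φ ψ (Q * g))
            = C (alpha q 1) * (X * f * pearsonOp q φ ψ (Q * g)) by ring,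
          ← smul_eq_C_mul, map_smul, smul_eq_mul] at e
        exact (mul_eq_zero.mp e).resolve_left hα
      refine ⟨h3, fun g => ?_⟩
      have e1 := h3 (X * g)
      have e2 := h2 (X * g)
      rw [hX, pearsonOp_X_mul,
        show X * f * (C (alpha q 1) * X * pearsonOp q φ ψ (Q * g) + pearsonOp' q φ ψ (Q * g))
          = C (alpha q 1) * (X * (X * f * pearsonOp q φ ψ (Q * g)))
            + X * f * pearsonOp' q φ ψ (Q * g) by ring,
        map_add, ← smul_eq_C_mul, map_smul, smul_eq_mul] at e1
      rw [hX, pearsonOp'_X_mul,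
        show f * (C (alpha q 1) * X * pearsonOp' q φ ψ (Q * g)
            + C (alpha q 1 ^ 2 - 1) * (X ^ 2 - 1) * pearsonOp q φ ψ (Q * g))
          = C (alpha q 1) * (X * f * pearsonOp' q φ ψ (Q * g))
            + (C (alpha q 1 ^ 2 - 1) * (X * (X * f * pearsonOp q φ ψ (Q * g)))
              - C (alpha q 1 ^ 2 - 1) * (f * pearsonOp q φ ψ (Q * g))) by ring,
        map_add, map_sub, ← smul_eq_C_mul, ← smul_eq_C_mul, ← smul_eq_C_mul, map_smul, map_smul,
        map_smul, h1, smul_eq_mul, smul_eq_mul, smul_zero, sub_zero] at e2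
      linear_combination alpha q 1 * e2 - (alpha q 1 ^ 2 - 1) * e1
  have hall : ∀ g, pearsonOp q φ ψ (Q * g) = 0 := fun g =>
    hP.eq_zero_of_forall fun f => (key f).1 g
  have h1 : φ.coeff 2 * gamma q (n + 1 : ℕ) + ψ.coeff 1 * alpha q (n + 1 : ℕ) = 0 := by
    have hd : (Q * X).natDegree ≤ n + 1 := natDegree_mul_le.trans (by rw [natDegree_X]; omega)
    have := (pearsonOp_natDegree_and_coeff hq0 hq1 hφ hψ hd).2
    rw [hall, coeff_zero, coeff_mul_X] at this
    exact (mul_eq_zero.mp this.symm).resolve_right hQ0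
  push_cast at h1
  rw [gamma_succ hq0 hq1, alpha_succ hq0 hq1] at h1
  -- `α_n² - (α² - 1) γ_n² = 1`, so two consecutive leading coefficients cannot both vanish
  have hdet : alpha q n ^ 2 - (alpha q 1 ^ 2 - 1) * gamma q n ^ 2 = 1 := by
    have hs := sqrtQ_ne_zero hq0
    have hs2 := sqrtQ_sub_inv_ne_zero hq0 hq1
    have h4 : alpha q 1 ^ 2 - 1 = (sqrtQ q - (sqrtQ q)⁻¹) ^ 2 / 4 := by
      rw [alpha_one hq0]; field_simp; ring
    have h5 : sqrtQ q ^ n ≠ 0 := pow_ne_zero _ hs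
    have h6 : ∀ x y : ℂ, y ≠ 0 → y ^ 2 / 4 * (x / y) ^ 2 = x ^ 2 / 4 := fun x y hy => by
      field_simp
    rw [h4, gamma_eq hq0, alpha_eq hq0, zpow_natCast, h6 _ _ hs2]
    field_simp
    ring
  apply hψ1
  linear_combination (alpha q n + alpha q 1 * gamma q n) * h0 - gamma q n * h1
    - ψ.coeff 1 * hdet

/-! ### From the structure relation to the Pearson equation -/

/-- The functional `P_n u / ⟨u, P_n²⟩`, which takes `f` to the coefficient of `P_n` in `f`. -/
def dualP (u : ℂ[X] →ₗ[ℂ] ℂ) (P : ℕ → ℂ[X]) (n : ℕ) : ℂ[X] →ₗ[ℂ] ℂ :=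
  (u (P n * P n))⁻¹ • polyMul (P n) u

theorem dualP_apply (u : ℂ[X] →ₗ[ℂ] ℂ) (P : ℕ → ℂ[X]) (n : ℕ) (f : ℂ[X]) :
    dualP u P n f = (u (P n * P n))⁻¹ * u (P n * f) := rfl

namespace IsMonicOPS

variable {u : ℂ[X] →ₗ[ℂ] ℂ} {P : ℕ → ℂ[X]}

theorem dualP_self (hP : IsMonicOPS u P) (n : ℕ) : dualP u P n (P n) = 1 :=
  inv_mul_cancel₀ (hP.norm_ne_zero n)

theorem dualP_of_ne (hP : IsMonicOPS u P) {n m : ℕ} (h : n ≠ m) : dualP u P n (P m) = 0 := by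
  rw [dualP_apply, hP.orthogonal n m h, mul_zero]

theorem dualP_eq_ite (hP : IsMonicOPS u P) (n m : ℕ) :
    dualP u P n (P m) = if n = m then 1 else 0 := by
  split_ifs with h
  · rw [h, hP.dualP_self]
  · exact hP.dualP_of_ne h

theorem dualP_prevPoly (hP : IsMonicOPS u P) (n m : ℕ) :
    dualP u P n (prevPoly P m) = if n + 1 = m then 1 else 0 := by
  cases m with
  | zero => simp [prevPoly]
  | succ m => rw [prevPoly, hP.dualP_eq_ite]; simp

theorem dualP_zero_X_mul (hP : IsMonicOPS u P) (f : ℂ[X]) :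
    dualP u P 0 (X * f) = recB u P 0 * dualP u P 0 f + recC u P 1 * dualP u P 1 f := by
  have h0 := hP.norm_ne_zero 0
  have h1 := hP.norm_ne_zero 1
  simp only [dualP_apply]
  rw [show P 0 * (X * f) = X * P 0 * f by ring, hP.recurrence 0, prevPoly, mul_zero, add_zero,
    add_mul, mul_assoc, map_add, ← smul_eq_C_mul, map_smul, smul_eq_mul, ← hP.recC_succ_mul 0]
  have := hP.recC_succ_ne_zero 0
  rw [zero_add] at this ⊢
  field_simp
  ring

theorem dualP_succ_X_mul (hP : IsMonicOPS u P) (n : ℕ) (f : ℂ[X]) :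
    dualP u P (n + 1) (X * f) = dualP u P n f + recB u P (n + 1) * dualP u P (n + 1) f
      + recC u P (n + 2) * dualP u P (n + 2) f := by
  have h0 := hP.norm_ne_zero n
  have h1 := hP.recC_succ_ne_zero n
  have h2 := hP.recC_succ_ne_zero (n + 1)
  simp only [dualP_apply]
  rw [show P (n + 1) * (X * f) = X * P (n + 1) * f by ring, hP.recurrence (n + 1), prevPoly,
    add_mul, add_mul, mul_assoc, mul_assoc, map_add, map_add, ← smul_eq_C_mul, map_smul,
    ← smul_eq_C_mul, map_smul, smul_eq_mul, smul_eq_mul, ← hP.recC_succ_mul (n + 1),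
    ← hP.recC_succ_mul n]
  rw [show n + 1 + 1 = n + 2 from rfl] at *
  field_simp
  ring

end IsMonicOPS

/-- The rule `𝐃_q (π v) = π̂ 𝐃_q v + (2az + b/α) 𝐒_q v` for `π = az² + bz + c` and
`π̂ = az² + (b/α)z + c + a(1 - α²)`, written on polynomials. -/
theorem quadratic_mul_Dq {q : ℝ} (hq : 0 < q) (a b c : ℂ) (f : ℂ[X]) :
    (C a * X ^ 2 + C b * X + C c) * Dq q f
      = Dq q ((C a * X ^ 2 + C (b / alpha q 1) * X + C (c + a * (1 - alpha q 1 ^ 2))) * f)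
        - Sq q ((C (2 * a) * X + C (b / alpha q 1)) * f) := by
  have hα := alpha_ne_zero hq 1
  have hb : C (b / alpha q 1) * C (alpha q 1) = C b := by
    rw [← C_mul, div_mul_cancel₀ _ hα]
  have e1 : (C a * X ^ 2 + C (b / alpha q 1) * X + C (c + a * (1 - alpha q 1 ^ 2))) * f
      = C a * (X * (X * f)) + C (b / alpha q 1) * (X * f) + C (c + a * (1 - alpha q 1 ^ 2)) * f := by
    ring
  have e2 : (C (2 * a) * X + C (b / alpha q 1)) * f
      = C (2 * a) * (X * f) + C (b / alpha q 1) * f := by ring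
  rw [e1, e2]
  simp only [map_add (Dq q), map_add (Sq q), Dq_C_mul, Sq_C_mul, Dq_X_mul, Sq_X_mul]
  simp only [C_mul, C_add, C_sub, C_pow, C_1, ← hb, map_ofNat]
  ring

section Structure

variable {q : ℝ} {u : ℂ[X] →ₗ[ℂ] ℂ} {P : ℕ → ℂ[X]}

/-- The functional dual to the basis `S_q P_n`. -/
def dualSq (hS : Function.Bijective (Sq q)) (u : ℂ[X] →ₗ[ℂ] ℂ) (P : ℕ → ℂ[X]) (n : ℕ) :
    ℂ[X] →ₗ[ℂ] ℂ :=
  dualP u P n ∘ₗ (LinearEquiv.ofBijective (Sq q) hS).symm.toLinearMap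

theorem dualSq_Sq (hS : Function.Bijective (Sq q)) (n : ℕ) (f : ℂ[X]) :
    dualSq hS u P n (Sq q f) = dualP u P n f := by
  have : (LinearEquiv.ofBijective (Sq q) hS).symm (Sq q f) = f :=
    (LinearEquiv.ofBijective (Sq q) hS).symm_apply_apply f
  rw [dualSq, LinearMap.comp_apply, LinearEquiv.coe_coe, this]

variable {a b c : ℂ} {an bn cn : ℕ → ℂ}

/-- The structure relation, read on the functionals dual to `S_q P_n`. -/
theorem dualSq_P (hP : IsMonicOPS u P)
    (heq : ∀ n : ℕ, (C a * X ^ 2 + C b * X + C c) * Dq q (P n)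
        = C (an n) * Sq q (P (n + 1)) + C (bn n) * Sq q (P n) + C (cn n) * Sq q (prevPoly P n))
    (hS : Function.Bijective (Sq q)) (n m : ℕ) :
    dualSq hS u P n ((C a * X ^ 2 + C b * X + C c) * Dq q (P m))
      = (if n = m + 1 then an m else 0) + (if n = m then bn m else 0)
        + (if n + 1 = m then cn m else 0) := by
  rw [heq]
  simp only [map_add, ← smul_eq_C_mul, map_smul, dualSq_Sq, hP.dualP_eq_ite, hP.dualP_prevPoly,
    smul_eq_mul, mul_ite, mul_one, mul_zero]

theorem dualSq_zero_structure (hP : IsMonicOPS u P)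
    (heq : ∀ n : ℕ, (C a * X ^ 2 + C b * X + C c) * Dq q (P n)
        = C (an n) * Sq q (P (n + 1)) + C (bn n) * Sq q (P n) + C (cn n) * Sq q (prevPoly P n))
    (hS : Function.Bijective (Sq q)) (f : ℂ[X]) :
    dualSq hS u P 0 ((C a * X ^ 2 + C b * X + C c) * Dq q f)
      = bn 0 * dualP u P 0 f + cn 1 * dualP u P 1 f := by
  have : dualSq hS u P 0 ∘ₗ LinearMap.mulLeft ℂ (C a * X ^ 2 + C b * X + C c) ∘ₗ Dq q
      = bn 0 • dualP u P 0 + cn 1 • dualP u P 1 := by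
    refine ext_of_monic hP.monic hP.natDegree fun m => ?_
    simp only [LinearMap.comp_apply, LinearMap.mulLeft_apply, dualSq_P hP heq,
      LinearMap.add_apply, LinearMap.smul_apply, hP.dualP_eq_ite, smul_eq_mul, mul_ite, mul_one,
      mul_zero]
    rcases m with _ | _ | m <;> simp
  exact LinearMap.congr_fun this f

theorem dualSq_succ_structure (hP : IsMonicOPS u P)
    (heq : ∀ n : ℕ, (C a * X ^ 2 + C b * X + C c) * Dq q (P n)
        = C (an n) * Sq q (P (n + 1)) + C (bn n) * Sq q (P n) + C (cn n) * Sq q (prevPoly P n))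
    (hS : Function.Bijective (Sq q)) (n : ℕ) (f : ℂ[X]) :
    dualSq hS u P (n + 1) ((C a * X ^ 2 + C b * X + C c) * Dq q f)
      = an n * dualP u P n f + bn (n + 1) * dualP u P (n + 1) f
        + cn (n + 2) * dualP u P (n + 2) f := by
  have : dualSq hS u P (n + 1) ∘ₗ LinearMap.mulLeft ℂ (C a * X ^ 2 + C b * X + C c) ∘ₗ Dq q
      = an n • dualP u P n + bn (n + 1) • dualP u P (n + 1) + cn (n + 2) • dualP u P (n + 2) := by
    refine ext_of_monic hP.monic hP.natDegree fun m => ?_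
    simp only [LinearMap.comp_apply, LinearMap.mulLeft_apply, dualSq_P hP heq,
      LinearMap.add_apply, LinearMap.smul_apply, hP.dualP_eq_ite, smul_eq_mul, mul_ite, mul_one,
      mul_zero]
    congr 1
    · congr 1
      · by_cases h : n = m <;> simp [h]
      · by_cases h : n + 1 = m <;> simp [h]
    · by_cases h : n + 2 = m <;> simp [h]
  exact LinearMap.congr_fun this f

/-- A linear functional that vanishes on `1` and on `X` and on the multiples of a nonzero
polynomial of degree at most two is zero. -/
theorem eq_zero_of_vanish_on_multiples {Θ : ℂ[X] →ₗ[ℂ] ℂ} {g : ℂ[X]} (hg : g ≠ 0)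
    (hd : g.natDegree ≤ 2) (h0 : Θ 1 = 0) (h1 : Θ X = 0) (h : ∀ f, Θ (g * f) = 0) : Θ = 0 := by
  refine LinearMap.ext fun f => ?_
  have hlt : (f % g).natDegree ≤ 1 := by
    by_cases hg0 : g.natDegree = 0
    · have hunit : IsUnit g := by
        rw [isUnit_iff_degree_eq_zero, degree_eq_natDegree hg, hg0, Nat.cast_zero]
      rw [EuclideanDomain.mod_eq_zero.mpr hunit.dvd, natDegree_zero]
      exact zero_le_one
    · have := natDegree_mod_lt f hg0
      omega
  obtain ⟨x, y, hxy⟩ := exists_eq_X_add_C_of_natDegree_le_one hlt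
  have h1' : Θ (C x * X) = 0 := by rw [← smul_eq_C_mul, map_smul, h1, smul_zero]
  have h0' : Θ (C y) = 0 := by rw [← mul_one (C y), ← smul_eq_C_mul, map_smul, h0, smul_zero]
  rw [← EuclideanDomain.div_add_mod f g, map_add, h, hxy, map_add, h1', h0', LinearMap.zero_apply]
  norm_num

/-- Under the two conditions, `P_1 u / ⟨u, P_1²⟩ = - 𝐃_q v`, where `v` is an explicit combination
of the first three functionals dual to the basis `S_q P_n`. The difference `Θ` of the two sides
vanishes on `1`, `X`, `X²`, and the first condition makes it vanish on `X³` when `a ≠ 0`. The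
product of `Θ` with the quadratic `π̂` of `quadratic_mul_Dq` is a combination of the functionals
`P_i u`, `i ≤ 3`; the terms `i = 3` and `i = 2` cancel, the latter by the second condition, and
the values of `Θ` on low degrees eliminate the others. Hence `π̂ Θ = 0`, and `Θ = 0`. -/
theorem dualP_one_eq (hq0 : 0 < q) (hP : IsMonicOPS u P) (hcn : ∀ n, cn n ≠ 0)
    (heq : ∀ n : ℕ, (C a * X ^ 2 + C b * X + C c) * Dq q (P n)
        = C (an n) * Sq q (P (n + 1)) + C (bn n) * Sq q (P n) + C (cn n) * Sq q (prevPoly P n))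
    {B Cc : ℕ → ℂ} (hB : B = recB u P) (hCc : Cc = recC u P)
    {α r₂ r₃ : ℂ} (hα : α = alpha q 1)
    (hr₂ : r₂ = cn 2 + 2 * a * Cc 2) (hr₃ : r₃ = cn 3 + 2 * a * Cc 3)
    (hcond₁ : a ≠ 0 →
      (4 * α ^ 2 - 1) * a * Cc 2 * Cc 3
        + r₃ / 2 * ((B 0 + B 1) ^ 2 + 4 * α ^ 2 * (Cc 1 - B 0 * B 1 + α ^ 2 - 1)
            - 2 * (2 * α ^ 2 - 1) * Cc 2) = 0)
    (hcond₂ :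
      a * Cc 2 * Cc 3 * (bn 2 + 2 * a * B 2 + b / α)
        - r₃ * (a * (B 2 + B 1) * Cc 2 + b / α * Cc 2 - r₂ / 2 * (B 1 - B 0)) = 0)
    (hr : r₃ ≠ 0) (hα2 : 2 * α ^ 2 - 1 ≠ 0) (hS : Function.Bijective (Sq q)) (f : ℂ[X]) :
    dualP u P 1 f = a * (Cc 3 / r₃) * Cc 2 * dualSq hS u P 2 (Dq q f)
      + (B 1 - B 0) / 2 * dualSq hS u P 1 (Dq q f) + dualSq hS u P 0 (Dq q f) := by
  have hα0 : α ≠ 0 := hα ▸ alpha_ne_zero hq0 1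
  obtain ⟨k, hk⟩ : ∃ k, k = Cc 3 / r₃ := ⟨_, rfl⟩
  have hkr : k * r₃ = Cc 3 := by rw [hk, div_mul_cancel₀ _ hr]
  rw [← hk]
  set s := dualSq hS u P with hs
  set p := dualP u P with hp
  set Θ : ℂ[X] →ₗ[ℂ] ℂ := p 1 - (a * k * Cc 2) • (s 2 ∘ₗ Dq q)
    - ((B 1 - B 0) / 2) • (s 1 ∘ₗ Dq q) - s 0 ∘ₗ Dq q with hΘ
  have Θ_apply : ∀ f, Θ f = p 1 f - a * k * Cc 2 * s 2 (Dq q f)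
      - (B 1 - B 0) / 2 * s 1 (Dq q f) - s 0 (Dq q f) := fun f => rfl
  suffices h : Θ = 0 by
    have := Θ_apply f
    rw [h, LinearMap.zero_apply] at this
    linear_combination -this
  -- multiplication by `X` on the dual basis
  have p0X : ∀ f, p 0 (X * f) = B 0 * p 0 f + Cc 1 * p 1 f := by
    rw [hB, hCc]; exact hP.dualP_zero_X_mul
  have p1X : ∀ f, p 1 (X * f) = p 0 f + B 1 * p 1 f + Cc 2 * p 2 f := by
    rw [hB, hCc]; exact hP.dualP_succ_X_mul 0
  have p2X : ∀ f, p 2 (X * f) = p 1 f + B 2 * p 2 f + Cc 3 * p 3 f := by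
    rw [hB, hCc]; exact hP.dualP_succ_X_mul 1
  have p01 : p 0 1 = 1 := by rw [← hP.apply_zero]; exact hP.dualP_self 0
  have pn1 : ∀ n, n ≠ 0 → p n 1 = 0 := fun n hn => by
    rw [← hP.apply_zero]; exact hP.dualP_of_ne hn
  have hSq : ∀ n f, s n (Sq q f) = p n f := fun n f => dualSq_Sq hS n f
  have smulC : ∀ (v : ℂ[X] →ₗ[ℂ] ℂ) (x : ℂ) (f : ℂ[X]), v (C x * f) = x * v f := fun v x f => by
    rw [← smul_eq_C_mul, map_smul, smul_eq_mul]
  -- the values of the dual functionals on low powers of `X`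
  have s1 : ∀ n, s n 1 = p n 1 := fun n => by rw [← hSq, Sq_one]
  have pX : ∀ n, p n X = p n (X * 1) := fun n => by rw [mul_one]
  have sX : ∀ n, α * s n X = p n X := fun n => by rw [← hSq, Sq_X, smulC, hα]
  have sX2 : ∀ n, (2 * α ^ 2 - 1) * s n (X * X) = p n (X * X) + (α ^ 2 - 1) * s n 1 := fun n => by
    have e : Sq q (X * X) = C (2 * α ^ 2 - 1) * (X * X) - C (α ^ 2 - 1) * 1 := by
      rw [Sq_X_mul, Sq_X, Dq_X, ← hα]
      simp only [C_sub, C_mul, C_pow, C_1, map_ofNat]; ring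
    have h1 := hSq n (X * X)
    rw [e, map_sub, smulC, smulC] at h1
    linear_combination h1
  have DX2 : Dq q (X * X) = C (2 * α) * X := by
    rw [Dq_X_mul, Sq_X, Dq_X, ← hα]; simp only [C_mul, map_ofNat]; ring
  have DX3 : Dq q (X * (X * X)) = C (4 * α ^ 2 - 1) * (X * X) - C (α ^ 2 - 1) * 1 := by
    rw [Dq_X_mul, DX2, Sq_X_mul, Sq_X, Dq_X, ← hα]
    simp only [C_sub, C_mul, C_pow, C_1, map_ofNat]; ring
  have Θ1 : Θ 1 = 0 := by
    rw [Θ_apply, Dq_one, map_zero, map_zero, map_zero, pn1 1 one_ne_zero]; ring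
  have ΘX : Θ X = 0 := by
    rw [Θ_apply, Dq_X, s1, s1, s1, pX, p1X, p01, pn1 1 one_ne_zero, pn1 2 two_ne_zero]; ring
  have ΘX2 : Θ (X * X) = 0 := by
    have e0 := sX 0
    have e1 := sX 1
    have e2 := sX 2
    rw [pX, p0X, p01, pn1 1 one_ne_zero] at e0
    rw [pX, p1X, p01, pn1 1 one_ne_zero, pn1 2 two_ne_zero] at e1
    rw [pX, p2X, pn1 1 one_ne_zero, pn1 2 two_ne_zero, pn1 3 three_ne_zero] at e2
    rw [Θ_apply, DX2, smulC, smulC, smulC, p1X, pX, pX, pX, p0X, p1X, p2X, p01,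
      pn1 1 one_ne_zero, pn1 2 two_ne_zero, pn1 3 three_ne_zero]
    linear_combination (-2 * a * k * Cc 2) * e2 - (B 1 - B 0) * e1 - 2 * e0
  have ΘX3 : a ≠ 0 → Θ (X * (X * X)) = 0 := by
    intro ha
    have h1 := hcond₁ ha
    have e0 := sX2 0
    have e1 := sX2 1
    have e2 := sX2 2
    rw [s1, p0X, pX, p0X, pX, p1X, p01, pn1 1 one_ne_zero, pn1 2 two_ne_zero] at e0
    rw [s1, p1X, pX, p0X, pX, p1X, pX, p2X, p01, pn1 1 one_ne_zero, pn1 2 two_ne_zero,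
      pn1 3 three_ne_zero] at e1
    have hp3 : p 3 X = 0 := by
      rw [pX, show p 3 (X * 1) = p 2 1 + recB u P 3 * p 3 1 + recC u P 4 * p 4 1 from
        hP.dualP_succ_X_mul 2 1, pn1 2 two_ne_zero, pn1 3 three_ne_zero, pn1 4 four_ne_zero]
      ring
    rw [s1, p2X, pX, p1X, pX, p2X, hp3, p01, pn1 1 one_ne_zero, pn1 2 two_ne_zero,
      pn1 3 three_ne_zero] at e2
    have h2 : (2 * α ^ 2 - 1) * Θ (X * (X * X)) = 0 := by
      rw [Θ_apply, DX3, map_sub (s 2), map_sub (s 1), map_sub (s 0), smulC, smulC, smulC, smulC, smulC, smulC, s1,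
        s1, s1, p1X, p0X, p1X, p2X, hp3, pX 0, pX 1, pX 2, p0X, p1X, p2X, p01,
        pn1 1 one_ne_zero, pn1 2 two_ne_zero, pn1 3 three_ne_zero]
      have h3 : r₃ * ((4 * α ^ 2 - 1) * a * k * Cc 2
        + 1 / 2 * ((B 0 + B 1) ^ 2 + 4 * α ^ 2 * (Cc 1 - B 0 * B 1 + α ^ 2 - 1)
            - 2 * (2 * α ^ 2 - 1) * Cc 2)) = 0 := by
        linear_combination h1 + (4 * α ^ 2 - 1) * a * Cc 2 * hkr
      have h4 := (mul_eq_zero.mp h3).resolve_left hr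
      linear_combination -h4 - (4 * α ^ 2 - 1) * (a * k * Cc 2 * e2 + (B 1 - B 0) / 2 * e1 + e0)
    exact (mul_eq_zero.mp h2).resolve_left hα2
  -- the product of `Θ` with the quadratic polynomial is a combination of `P_0 u` and `P_1 u`
  set g : ℂ[X] := C a * X ^ 2 + C (b / α) * X + C (c + a * (1 - α ^ 2)) with hg
  have hgf : ∀ f, g * f = C a * (X * (X * f)) + C (b / α) * (X * f)
      + C (c + a * (1 - α ^ 2)) * f := fun f => by rw [hg]; ring
  have hsD : ∀ n f, s n (Dq q (g * f)) = s n ((C a * X ^ 2 + C b * X + C c) * Dq q f)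
      + (2 * a * p n (X * f) + b / α * p n f) := by
    intro n f
    have h1 := congrArg (s n) (quadratic_mul_Dq hq0 a b c f)
    rw [← hα, ← hg, map_sub, hSq, show (C (2 * a) * X + C (b / α)) * f
      = C (2 * a) * (X * f) + C (b / α) * f by ring, map_add, smulC, smulC] at h1
    linear_combination -h1
  obtain ⟨x₀, x₁, hx⟩ : ∃ x₀ x₁, ∀ f, Θ (g * f) = x₀ * p 0 f + x₁ * p 1 f := by
    refine ⟨a * (B 0 + B 1) + b / α - (B 1 - B 0) / 2 * (an 0 + 2 * a)
        - (bn 0 + 2 * a * B 0 + b / α),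
      a * (Cc 1 + B 1 ^ 2 + Cc 2) + b / α * B 1 + (c + a * (1 - α ^ 2))
        - a * k * Cc 2 * (an 1 + 2 * a) - (B 1 - B 0) / 2 * (bn 1 + 2 * a * B 1 + b / α)
        - (cn 1 + 2 * a * Cc 1), fun f => ?_⟩
    · rw [Θ_apply, hsD, hsD, hsD, dualSq_zero_structure hP heq,
        show s 1 ((C a * X ^ 2 + C b * X + C c) * Dq q f)
          = an 0 * p 0 f + bn 1 * p 1 f + cn 2 * p 2 f from dualSq_succ_structure hP heq hS 0 f,
        show s 2 ((C a * X ^ 2 + C b * X + C c) * Dq q f)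
          = an 1 * p 1 f + bn 2 * p 2 f + cn 3 * p 3 f from dualSq_succ_structure hP heq hS 1 f,
        hgf, map_add, map_add, smulC, smulC, smulC, p1X (X * f), p0X, p1X, p2X, ← hp]
      have h2 : r₃ * (a * k * Cc 2 * (bn 2 + 2 * a * B 2 + b / α)
        - (a * (B 2 + B 1) * Cc 2 + b / α * Cc 2 - r₂ / 2 * (B 1 - B 0))) = 0 := by
        linear_combination hcond₂ + a * Cc 2 * (bn 2 + 2 * a * B 2 + b / α) * hkr
      have h3 := (mul_eq_zero.mp h2).resolve_left hr
      rw [hr₂] at h3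
      rw [hr₃] at hkr
      linear_combination (exp := 1) - p 2 f * h3 - a * Cc 2 * p 3 f * hkr
  have hx0 : x₀ = 0 := by
    have := hx 1
    rw [p01, pn1 1 one_ne_zero, hgf, map_add, map_add, smulC, smulC, smulC, mul_one, Θ1, ΘX,
      ΘX2] at this
    linear_combination -this
  have hx1 : x₁ = 0 := by
    have h1 := hx X
    rw [hx0, pX 1, p1X, p01, pn1 1 one_ne_zero, pn1 2 two_ne_zero, hgf, map_add, map_add, smulC,
      smulC, smulC, ΘX, ΘX2] at h1
    by_cases ha : a = 0
    · rw [ha] at h1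
      linear_combination -h1
    · rw [ΘX3 ha] at h1
      linear_combination -h1
  have hg0 : g ≠ 0 := by
    intro h0
    have hcoeff : ∀ x y z : ℂ, (C x * X ^ 2 + C y * X + C z).coeff 2 = x ∧
        (C x * X ^ 2 + C y * X + C z).coeff 1 = y ∧ (C x * X ^ 2 + C y * X + C z).coeff 0 = z :=
      fun x y z => by simp [coeff_X, coeff_C]
    obtain ⟨c2, c1, c0⟩ := hcoeff a (b / α) (c + a * (1 - α ^ 2))
    rw [← hg] at c2 c1 c0
    rw [h0, coeff_zero] at c2 c1 c0
    have hb : b = 0 := by rw [eq_comm, div_eq_zero_iff] at c1; exact c1.resolve_right hα0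
    have hc : c = 0 := by rw [← c2] at c0; linear_combination -c0
    have h1 := dualSq_P hP heq hS 0 1
    rw [← c2, hb, hc] at h1
    simp at h1
    exact hcn 1 h1.symm
  refine eq_zero_of_vanish_on_multiples hg0 ?_ Θ1 ΘX fun f => ?_
  · rw [hg]; exact natDegree_quadratic_le
  · rw [hx, hx0, hx1]; ring

/-- The Pearson equation `𝐃_q (φ u) = 𝐒_q (ψ u)`, tested on `f`. It results from applying `𝐒_q` to
`dualP_one_eq`: the commutation rule turns `𝐒_q 𝐃_q v` into `𝐃_q` of `𝐒_q v` and of `z 𝐃_q v`,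
both of which are polynomial multiples of `u`. -/
theorem pearson_of_structure (hq0 : 0 < q) (hq1 : q < 1) (hP : IsMonicOPS u P)
    (hcn : ∀ n, cn n ≠ 0)
    (heq : ∀ n : ℕ, (C a * X ^ 2 + C b * X + C c) * Dq q (P n)
        = C (an n) * Sq q (P (n + 1)) + C (bn n) * Sq q (P n) + C (cn n) * Sq q (prevPoly P n))
    {B Cc : ℕ → ℂ} (hB : B = recB u P) (hCc : Cc = recC u P)
    {α r₂ r₃ : ℂ} (hα : α = alpha q 1)
    (hr₂ : r₂ = cn 2 + 2 * a * Cc 2) (hr₃ : r₃ = cn 3 + 2 * a * Cc 3)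
    (hcond₁ : a ≠ 0 →
      (4 * α ^ 2 - 1) * a * Cc 2 * Cc 3
        + r₃ / 2 * ((B 0 + B 1) ^ 2 + 4 * α ^ 2 * (Cc 1 - B 0 * B 1 + α ^ 2 - 1)
            - 2 * (2 * α ^ 2 - 1) * Cc 2) = 0)
    (hcond₂ :
      a * Cc 2 * Cc 3 * (bn 2 + 2 * a * B 2 + b / α)
        - r₃ * (a * (B 2 + B 1) * Cc 2 + b / α * Cc 2 - r₂ / 2 * (B 1 - B 0)) = 0)
    (hr : r₃ ≠ 0) {A B' C' : ℂ}
    (hA : A = -((a * Cc 3 + (α ^ 2 - 1) * r₃) / (α * r₃)))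
    (hB' : B' = -(1 / (2 * α)) *
      ((1 - 2 * a * (Cc 3 / r₃)) * (B 0 + B 1) - 2 * α ^ 2 * B 0))
    (hC' : C' = -(1 / (2 * α)) *
      ((1 - 2 * a * (Cc 3 / r₃)) * (Cc 1 - B 0 * B 1) + Cc 1 + B 0 ^ 2)) (f : ℂ[X]) :
    u (pearsonOp q (C A * X ^ 2 + C B' * X + C C') (X - C (B 0)) f) = 0 := by
  have hα0 : α ≠ 0 := hα ▸ alpha_ne_zero hq0 1
  have hα2 : 2 * α ^ 2 - 1 ≠ 0 := by
    have h2 := alpha_succ hq0 hq1 1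
    rw [gamma_one hq0 hq1, ← hα] at h2
    have h3 := alpha_ne_zero hq0 (1 + 1)
    rw [h2] at h3
    intro h4
    apply h3
    linear_combination h4
  have hS := Sq_bijective hq0 hq1
  have key := dualP_one_eq hq0 hP hcn heq hB hCc hα hr₂ hr₃ hcond₁ hcond₂ hr hα2 hS
  obtain ⟨k, hk⟩ : ∃ k, k = Cc 3 / r₃ := ⟨_, rfl⟩
  have hA1 : α * A = -(a * k + α ^ 2 - 1) := by rw [hA, hk]; field_simp; ring
  rw [← hk] at key hB' hC'
  have hB1 : 2 * α * B' = -((1 - 2 * a * k) * (B 0 + B 1) - 2 * α ^ 2 * B 0) := by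
    rw [hB']; field_simp
  have hC1 : 2 * α * C' = -((1 - 2 * a * k) * (Cc 1 - B 0 * B 1) + Cc 1 + B 0 ^ 2) := by
    rw [hC']; field_simp
  set p := dualP u P with hp
  have p0X : ∀ f, p 0 (X * f) = B 0 * p 0 f + Cc 1 * p 1 f := by
    rw [hB, hCc]; exact hP.dualP_zero_X_mul
  have p1X : ∀ f, p 1 (X * f) = p 0 f + B 1 * p 1 f + Cc 2 * p 2 f := by
    rw [hB, hCc]; exact hP.dualP_succ_X_mul 0
  have smulC : ∀ (v : ℂ[X] →ₗ[ℂ] ℂ) (x : ℂ) (f : ℂ[X]), v (C x * f) = x * v f := fun v x f => by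
    rw [← smul_eq_C_mul, map_smul, smul_eq_mul]
  have e1 : C α * Dq q (Sq q f) = Sq q (Dq q f) + C (α ^ 2 - 1) * Dq q (X * Dq q f) := by
    rw [Dq_Sq, Dq_X_mul, ← hα]; simp only [C_sub, C_pow, C_1]; ring
  have e2 : α * p 1 (Sq q f) = a * k * Cc 2 * p 2 (Dq q f) + (B 1 - B 0) / 2 * p 1 (Dq q f)
      + p 0 (Dq q f) + (α ^ 2 - 1) * p 1 (X * Dq q f) := by
    rw [← smulC, key, Dq_C_mul, e1]
    simp only [map_add, dualSq_Sq, smulC]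
    rw [key (X * Dq q f)]
    ring
  have hu0 : u 1 ≠ 0 := by have := hP.norm_ne_zero 0; rwa [hP.apply_zero, mul_one] at this
  have hu : ∀ f, u f = u 1 * p 0 f := fun f => by
    rw [hp, dualP_apply, hP.apply_zero, mul_one, one_mul, mul_inv_cancel_left₀ hu0]
  rw [pearsonOp, show (C A * X ^ 2 + C B' * X + C C') * Dq q f + (X - C (B 0)) * Sq q f
    = C A * (X * (X * Dq q f)) + C B' * (X * Dq q f) + C C' * Dq q f
      + (X * Sq q f - C (B 0) * Sq q f) by ring, hu]
  simp only [map_add, map_sub, smulC, p0X]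
  rw [p1X] at e2
  have h2α : 2 * α * (A * (B 0 * (B 0 * p 0 (Dq q f) + Cc 1 * p 1 (Dq q f))
      + Cc 1 * p 1 (X * Dq q f)) + B' * (B 0 * p 0 (Dq q f) + Cc 1 * p 1 (Dq q f))
      + C' * p 0 (Dq q f) + (B 0 * p 0 (Sq q f) + Cc 1 * p 1 (Sq q f) - B 0 * p 0 (Sq q f))) = 0 := by
    rw [p1X]
    generalize p 0 (Dq q f) = y0 at *
    generalize p 1 (Dq q f) = y1 at *
    generalize p 2 (Dq q f) = y2 at *
    linear_combination 2 * Cc 1 * e2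
      + 2 * (B 0 * (B 0 * y0 + Cc 1 * y1) + Cc 1 * (y0 + B 1 * y1 + Cc 2 * y2)) * hA1
      + (B 0 * y0 + Cc 1 * y1) * hB1 + y0 * hC1
  have := (mul_eq_zero.mp h2α).resolve_left (mul_ne_zero two_ne_zero hα0)
  rw [this, mul_zero]

end Structure

/-! ### The Askey-Wilson operator in factored form -/

/-- The polynomial `φ` of the second-order operator `φ D_q² + ψ S_q D_q` attached to a quartic
`H(w) = ∑ E_j w^j`: with `awPsi` it is determined by
`2 φ(x) + ψ(x) (q^{1/2} - q^{-1/2}) (w - w⁻¹) / 2 = w⁻² H(w)`, `x = (w + w⁻¹) / 2`. -/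
def awPhi (E : Fin 5 → ℂ) : ℂ[X] :=
  C (E 0 + E 4) * X ^ 2 + C ((E 1 + E 3) / 2) * X + C ((E 2 - E 0 - E 4) / 2)

/-- The polynomial `ψ` of the second-order operator attached to a quartic; see `awPhi`. -/
def awPsi (q : ℝ) (E : Fin 5 → ℂ) : ℂ[X] :=
  C (2 * (E 4 - E 0) / (sqrtQ q - (sqrtQ q)⁻¹)) * X + C ((E 3 - E 1) / (sqrtQ q - (sqrtQ q)⁻¹))

/-- The second-order operator attached to a quartic. -/
def awOp (q : ℝ) (E : Fin 5 → ℂ) (f : ℂ[X]) : ℂ[X] := pearsonOp q (awPhi E) (awPsi q E) (Dq q f)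

/-- The eigenvalue of `awOp` in degree `n`, that is `γ_n (φ₂ γ_{n-1} + ψ₁ α_{n-1})` with `φ₂`, `ψ₁`
the leading coefficients of `awPhi` and `awPsi`; see `eigenvalue_eq`. -/
def awEigenvalue (q : ℝ) (E : Fin 5 → ℂ) (n : ℕ) : ℂ :=
  2 * sqrtQ q / (sqrtQ q - (sqrtQ q)⁻¹) ^ 2 * (1 - ((q : ℂ) ^ n)⁻¹) * (E 4 * (q : ℂ) ^ n / q - E 0)

/-- The coefficients of `∏ i, (y_i - x_i w)`. -/
def quarticCoeff (x y : Fin 4 → ℂ) : Fin 5 → ℂ :=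
  ![y 0 * y 1 * y 2 * y 3,
    -(x 0 * y 1 * y 2 * y 3 + y 0 * x 1 * y 2 * y 3 + y 0 * y 1 * x 2 * y 3 + y 0 * y 1 * y 2 * x 3),
    x 0 * x 1 * y 2 * y 3 + x 0 * y 1 * x 2 * y 3 + x 0 * y 1 * y 2 * x 3 + y 0 * x 1 * x 2 * y 3
      + y 0 * x 1 * y 2 * x 3 + y 0 * y 1 * x 2 * x 3,
    -(x 0 * x 1 * x 2 * y 3 + x 0 * x 1 * y 2 * x 3 + x 0 * y 1 * x 2 * x 3 + y 0 * x 1 * x 2 * x 3),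
    x 0 * x 1 * x 2 * x 3]

/-- The polynomial `(t e^{iθ}, t e^{-iθ}; q)_k` in `z = cos θ`. -/
def awBase (q : ℝ) (t : ℂ) (k : ℕ) : ℂ[X] :=
  ∏ j ∈ Finset.range k, (1 - C (2 * t * (q : ℂ) ^ j) * X + C (t ^ 2 * (q : ℂ) ^ (2 * j)))

theorem awBase_zero (q : ℝ) (t : ℂ) : awBase q t 0 = 1 := rfl

theorem awBase_succ (q : ℝ) (t : ℂ) (k : ℕ) :
    awBase q t (k + 1) = awBase q t k
      * (1 - C (2 * t * (q : ℂ) ^ k) * X + C (t ^ 2 * (q : ℂ) ^ (2 * k))) :=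
  Finset.prod_range_succ _ _

theorem awBase_succ' (q : ℝ) (t : ℂ) (k : ℕ) :
    awBase q t (k + 1) = (1 - C (2 * t) * X + C (t ^ 2)) * awBase q (t * q) k := by
  rw [awBase, Finset.prod_range_succ', mul_comm, awBase]
  congr 1
  · simp
  · refine Finset.prod_congr rfl fun j _ => ?_
    rw [show 2 * (t * (q : ℂ)) * (q : ℂ) ^ j = 2 * t * (q : ℂ) ^ (j + 1) by ring,
      show (t * (q : ℂ)) ^ 2 * (q : ℂ) ^ (2 * j) = t ^ 2 * (q : ℂ) ^ (2 * (j + 1)) by ring]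

/-- Both operators lower the index of `awBase` and multiply the parameter by `q^{1/2}`. -/
theorem Dq_Sq_awBase {q : ℝ} (hq0 : 0 < q) (hq1 : q < 1) (t : ℂ) (k : ℕ) :
    Dq q (awBase q t (k + 1))
        = C (-2 * t * (sqrtQ q * (q : ℂ) ^ k - (sqrtQ q)⁻¹) / (sqrtQ q - (sqrtQ q)⁻¹))
          * awBase q (t * sqrtQ q) k ∧
      Sq q (awBase q t (k + 1))
        = awBase q (t * sqrtQ q) k * (C (1 + t ^ 2 * (q : ℂ) ^ k)
          - C (t * (sqrtQ q * (q : ℂ) ^ k + (sqrtQ q)⁻¹)) * X) := by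
  have hs := sqrtQ_ne_zero hq0
  have hd := sqrtQ_sub_inv_ne_zero hq0 hq1
  have hexp : ∀ (F : ℂ[X]) (x y : ℂ), F * (1 - C x * X + C y) = C (1 + y) * F - C x * (X * F) := by
    intro F x y; rw [C_add, C_1]; ring
  induction k with
  | zero =>
    rw [awBase_succ, awBase_zero, awBase_zero, hexp]
    simp only [map_sub (Dq q), map_sub (Sq q), Dq_C_mul, Sq_C_mul, mul_one, Dq_C, Sq_C, Dq_X,
      Sq_X, mul_zero, pow_zero]
    refine ⟨?_, ?_⟩
    · rw [mul_div_assoc, div_self hd, zero_sub, ← C_neg, mul_one, neg_mul]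
    · rw [← mul_assoc, ← C_mul, one_mul, alpha_one hq0]
      congr 3; ring
  | succ k ih =>
    rw [awBase_succ, hexp]
    simp only [map_sub (Dq q), map_sub (Sq q), Dq_C_mul, Sq_C_mul, Dq_X_mul, Sq_X_mul, ih.1, ih.2,
      awBase_succ q (t * sqrtQ q) k, alpha_one hq0]
    have hd2 : sqrtQ q ^ 2 - 1 ≠ 0 := by
      intro h; apply hd; field_simp; linear_combination h
    have e1 : (q : ℂ) ^ (k + 1) = (q : ℂ) ^ k * q := pow_succ _ _
    have e2 : (q : ℂ) ^ (2 * (k + 1)) = ((q : ℂ) ^ k) ^ 2 * q ^ 2 := by ring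
    have e3 : (q : ℂ) ^ (2 * k) = ((q : ℂ) ^ k) ^ 2 := by ring
    constructor <;>
    · refine Polynomial.funext fun z => ?_
      simp only [eval_add, eval_sub, eval_mul, eval_C, eval_X, eval_one, eval_pow, e1, e2, e3]
      generalize eval z (awBase q (t * sqrtQ q) k) = F
      generalize (q : ℂ) ^ k = y
      rw [← sqrtQ_sq hq0]
      field_simp
      ring

theorem Dq_awBase {q : ℝ} (hq0 : 0 < q) (hq1 : q < 1) (t : ℂ) (k : ℕ) :
    Dq q (awBase q t (k + 1))
        = C (-2 * t * (sqrtQ q * (q : ℂ) ^ k - (sqrtQ q)⁻¹) / (sqrtQ q - (sqrtQ q)⁻¹))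
          * awBase q (t * sqrtQ q) k :=
  (Dq_Sq_awBase hq0 hq1 t k).1

theorem Sq_awBase {q : ℝ} (hq0 : 0 < q) (hq1 : q < 1) (t : ℂ) (k : ℕ) :
    Sq q (awBase q t (k + 1))
        = awBase q (t * sqrtQ q) k * (C (1 + t ^ 2 * (q : ℂ) ^ k)
          - C (t * (sqrtQ q * (q : ℂ) ^ k + (sqrtQ q)⁻¹)) * X) :=
  (Dq_Sq_awBase hq0 hq1 t k).2

theorem awOp_C (q : ℝ) (E : Fin 5 → ℂ) (c : ℂ) : awOp q E (C c) = 0 := by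
  simp [awOp, pearsonOp, Dq_C]

theorem awOp_C_mul (q : ℝ) (E : Fin 5 → ℂ) (c : ℂ) (f : ℂ[X]) :
    awOp q E (C c * f) = C c * awOp q E f := by
  rw [awOp, Dq_C_mul, pearsonOp_C_mul, awOp]

theorem awOp_add (q : ℝ) (E : Fin 5 → ℂ) (f g : ℂ[X]) :
    awOp q E (f + g) = awOp q E f + awOp q E g := by
  rw [awOp, map_add, pearsonOp_add, awOp, awOp]

theorem awOp_sum (q : ℝ) (E : Fin 5 → ℂ) {ι : Type*} (s : Finset ι) (f : ι → ℂ[X]) :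
    awOp q E (∑ i ∈ s, f i) = ∑ i ∈ s, awOp q E (f i) := by
  classical
  induction s using Finset.induction_on with
  | empty => simpa using awOp_C q E 0
  | insert a s ha ih => rw [Finset.sum_insert ha, Finset.sum_insert ha, awOp_add, ih]

/-- In the basis `awBase q (t 0)` the Askey-Wilson operator is bidiagonal. -/
theorem awOp_awBase {q : ℝ} (hq0 : 0 < q) (hq1 : q < 1) (t : Fin 4 → ℂ) (k : ℕ) :
    awOp q (quarticCoeff t 1) (awBase q (t 0) (k + 1))
      = C (awEigenvalue q (quarticCoeff t 1) (k + 1)) * awBase q (t 0) (k + 1)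
        + C (2 * sqrtQ q / (sqrtQ q - (sqrtQ q)⁻¹) ^ 2 * (1 - ((q : ℂ) ^ (k + 1))⁻¹)
            * ((1 - t 0 * t 1 * (q : ℂ) ^ k) * (1 - t 0 * t 2 * (q : ℂ) ^ k)
              * (1 - t 0 * t 3 * (q : ℂ) ^ k))) * awBase q (t 0) k := by
  have hs := sqrtQ_ne_zero hq0
  have hd := sqrtQ_sub_inv_ne_zero hq0 hq1
  have hd2 : sqrtQ q ^ 2 - 1 ≠ 0 := by
    intro h; apply hd; field_simp; linear_combination h
  have hqk : ∀ k, (q : ℂ) ^ k ≠ 0 := fun k => by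
    rw [← sqrtQ_sq hq0]; exact pow_ne_zero _ (pow_ne_zero _ hs)
  have E0 : quarticCoeff t 1 0 = 1 := by simp [quarticCoeff]
  have E1 : quarticCoeff t 1 1 = -(t 0 + t 1 + t 2 + t 3) := by simp [quarticCoeff]
  have E2 : quarticCoeff t 1 2
      = t 0 * t 1 + t 0 * t 2 + t 0 * t 3 + t 1 * t 2 + t 1 * t 3 + t 2 * t 3 := by
    simp [quarticCoeff]
  have E3 : quarticCoeff t 1 3
      = -(t 0 * t 1 * t 2 + t 0 * t 1 * t 3 + t 0 * t 2 * t 3 + t 1 * t 2 * t 3) := by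
    simp [quarticCoeff]
  have E4 : quarticCoeff t 1 4 = t 0 * t 1 * t 2 * t 3 := by simp [quarticCoeff]
  rw [awOp, Dq_awBase hq0 hq1, pearsonOp_C_mul, pearsonOp, awPhi, awPsi, awEigenvalue, E0, E1, E2,
    E3, E4]
  generalize t 1 = t1
  generalize t 2 = t2
  generalize t 3 = t3
  generalize t 0 = t0
  cases k with
  | zero =>
    rw [awBase_zero, awBase_zero, Dq_one, Sq_one, awBase_succ, awBase_zero]
    refine Polynomial.funext fun z => ?_
    simp only [eval_add, eval_sub, eval_mul, eval_C, eval_X, eval_one, pow_zero, zero_add, pow_one, mul_zero]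
    rw [← sqrtQ_sq hq0]
    field_simp
    ring
  | succ k =>
    rw [Dq_awBase hq0 hq1, Sq_awBase hq0 hq1,
      show t0 * sqrtQ q * sqrtQ q = t0 * q by rw [← sqrtQ_sq hq0]; ring, awBase_succ q t0 (k + 1), awBase_succ' q t0 k]
    have e1 : (q : ℂ) ^ (k + 1) = (q : ℂ) ^ k * q := pow_succ _ _
    have e2 : (q : ℂ) ^ (2 * (k + 1)) = ((q : ℂ) ^ k) ^ 2 * q ^ 2 := by ring
    have e3 : (q : ℂ) ^ (k + 1 + 1) = (q : ℂ) ^ k * q ^ 2 := by ring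
    refine Polynomial.funext fun z => ?_
    simp only [eval_add, eval_sub, eval_mul, eval_C, eval_X, eval_one, eval_pow, e1, e2, e3]
    have hy := hqk k
    generalize eval z (awBase q (t0 * (q : ℂ)) k) = F
    generalize (q : ℂ) ^ k = y at hy ⊢
    rw [← sqrtQ_sq hq0]
    field_simp
    ring

theorem qPoch_succ (q : ℝ) (x : ℂ) (n : ℕ) :
    qPoch q x (n + 1) = qPoch q x n * (1 - x * (q : ℂ) ^ n) := Finset.prod_range_succ _ _

theorem qPoch_succ' (q : ℝ) (x : ℂ) (n : ℕ) :
    qPoch q x (n + 1) = (1 - x) * qPoch q (x * q) n := by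
  rw [qPoch, Finset.prod_range_succ', mul_comm, qPoch]
  congr 1
  · simp
  · exact Finset.prod_congr rfl fun j _ => by ring

/-- The coefficient of `awBase q (t 0) k` in `t 0 ^ n * askeyWilson q t n`. -/
def awCoeff (q : ℝ) (t : Fin 4 → ℂ) (n k : ℕ) : ℂ :=
  qPoch q ((q : ℂ) ^ (-(n : ℤ))) k
        * qPoch q (t 0 * t 1 * t 2 * t 3 * (q : ℂ) ^ ((n : ℤ) - 1)) k
        / qPoch q (q : ℂ) k * (q : ℂ) ^ k
        * qPoch q (t 0 * t 1 * (q : ℂ) ^ k) (n - k)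
        * qPoch q (t 0 * t 2 * (q : ℂ) ^ k) (n - k)
        * qPoch q (t 0 * t 3 * (q : ℂ) ^ k) (n - k)

theorem askeyWilson_eq (q : ℝ) (t : Fin 4 → ℂ) (n : ℕ) :
    askeyWilson q t n = C ((t 0 ^ n)⁻¹) * ∑ k ∈ Finset.range (n + 1),
      C (awCoeff q t n k) * awBase q (t 0) k := rfl

theorem qPoch_self_ne_zero {q : ℝ} (hq0 : 0 < q) (hq1 : q < 1) (k : ℕ) : qPoch q q k ≠ 0 := by
  refine Finset.prod_ne_zero_iff.mpr fun j _ h => q_pow_ne_one hq0 hq1 (n := j + 1) (by omega) ?_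
  rw [pow_succ]; linear_combination -h

/-- The recursion satisfied by the coefficients of an eigenfunction in the basis `awBase`. -/
theorem awCoeff_succ {q : ℝ} (hq0 : 0 < q) (hq1 : q < 1) (t : Fin 4 → ℂ) {n k : ℕ} (hk : k < n) :
    awCoeff q t n (k + 1) * (2 * sqrtQ q / (sqrtQ q - (sqrtQ q)⁻¹) ^ 2
        * (1 - ((q : ℂ) ^ (k + 1))⁻¹) * ((1 - t 0 * t 1 * (q : ℂ) ^ k)
          * (1 - t 0 * t 2 * (q : ℂ) ^ k) * (1 - t 0 * t 3 * (q : ℂ) ^ k)))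
      = awCoeff q t n k * (awEigenvalue q (quarticCoeff t 1) n
          - awEigenvalue q (quarticCoeff t 1) k) := by
  have hq : (q : ℂ) ≠ 0 := by exact_mod_cast hq0.ne'
  have hd := sqrtQ_sub_inv_ne_zero hq0 hq1
  have hp := qPoch_self_ne_zero hq0 hq1 k
  have hp1 : 1 - (q : ℂ) * (q : ℂ) ^ k ≠ 0 := fun h =>
    q_pow_ne_one hq0 hq1 (n := k + 1) (by omega) (by rw [pow_succ]; linear_combination -h)
  have E0 : quarticCoeff t 1 0 = 1 := by simp [quarticCoeff]
  have E4 : quarticCoeff t 1 4 = t 0 * t 1 * t 2 * t 3 := by simp [quarticCoeff]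
  have hshift : ∀ x : ℂ, qPoch q (x * (q : ℂ) ^ k) (n - k)
      = (1 - x * (q : ℂ) ^ k) * qPoch q (x * (q : ℂ) ^ (k + 1)) (n - (k + 1)) := fun x => by
    rw [show n - k = (n - (k + 1)) + 1 by omega, qPoch_succ', mul_assoc, ← pow_succ]
  rw [awCoeff, awCoeff, hshift, hshift, hshift, qPoch_succ q _ k, qPoch_succ q _ k,
    qPoch_succ q _ k, awEigenvalue, awEigenvalue, E0, E4, zpow_neg, zpow_sub_one₀ hq, zpow_natCast]
  have h1 : (q : ℂ) ^ n ≠ 0 := pow_ne_zero _ hq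
  have h2 : (q : ℂ) ^ k ≠ 0 := pow_ne_zero _ hq
  have h3 : (q : ℂ) ^ (k + 1) = q ^ k * q := pow_succ _ _
  generalize qPoch q ((q : ℂ) ^ n)⁻¹ k = x1
  generalize qPoch q (t 0 * t 1 * t 2 * t 3 * ((q : ℂ) ^ n * (q : ℂ)⁻¹)) k = x2
  generalize qPoch q (q : ℂ) k = x3 at *
  generalize qPoch q (t 0 * t 1 * (q : ℂ) ^ (k + 1)) (n - (k + 1)) = x4
  generalize qPoch q (t 0 * t 2 * (q : ℂ) ^ (k + 1)) (n - (k + 1)) = x5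
  generalize qPoch q (t 0 * t 3 * (q : ℂ) ^ (k + 1)) (n - (k + 1)) = x6
  rw [h3]
  generalize (q : ℂ) ^ n = y at *
  generalize (q : ℂ) ^ k = z at *
  generalize sqrtQ q - (sqrtQ q)⁻¹ = d at *
  generalize 1 - t 0 * t 1 * z = y1
  generalize 1 - t 0 * t 2 * z = y2
  generalize 1 - t 0 * t 3 * z = y3
  generalize t 0 * t 1 * t 2 * t 3 = e
  have hp2 : 1 - z * (q : ℂ) ≠ 0 := by rwa [mul_comm]
  field_simp
  ring

/-- The Askey-Wilson polynomials are eigenfunctions of the Askey-Wilson operator. -/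
theorem awOp_askeyWilson {q : ℝ} (hq0 : 0 < q) (hq1 : q < 1) (t : Fin 4 → ℂ) (n : ℕ) :
    awOp q (quarticCoeff t 1) (askeyWilson q t n)
      = C (awEigenvalue q (quarticCoeff t 1) n) * askeyWilson q t n := by
  rw [askeyWilson_eq, awOp_C_mul, mul_left_comm, awOp_sum]
  congr 1
  simp only [awOp_C_mul]
  rw [Finset.sum_range_succ', awBase_zero, ← C_1, awOp_C, mul_zero, add_zero]
  simp only [awOp_awBase hq0 hq1, mul_add, Finset.sum_add_distrib, ← mul_assoc, ← C_mul,
    Finset.mul_sum]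
  have h2 : ∑ k ∈ Finset.range n, C (awCoeff q t n (k + 1) * (2 * sqrtQ q
        / (sqrtQ q - (sqrtQ q)⁻¹) ^ 2 * (1 - ((q : ℂ) ^ (k + 1))⁻¹) * ((1 - t 0 * t 1 * (q : ℂ) ^ k)
          * (1 - t 0 * t 2 * (q : ℂ) ^ k) * (1 - t 0 * t 3 * (q : ℂ) ^ k)))) * awBase q (t 0) k
      = ∑ k ∈ Finset.range (n + 1), C (awCoeff q t n k * (awEigenvalue q (quarticCoeff t 1) n
          - awEigenvalue q (quarticCoeff t 1) k)) * awBase q (t 0) k := by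
    rw [Finset.sum_range_succ, sub_self, mul_zero, C_0, zero_mul, add_zero]
    refine Finset.sum_congr rfl fun k hk => ?_
    rw [awCoeff_succ hq0 hq1 t (Finset.mem_range.mp hk)]
  have h1 : ∑ k ∈ Finset.range n, C (awCoeff q t n (k + 1)
        * awEigenvalue q (quarticCoeff t 1) (k + 1)) * awBase q (t 0) (k + 1)
      = ∑ k ∈ Finset.range (n + 1), C (awCoeff q t n k
        * awEigenvalue q (quarticCoeff t 1) k) * awBase q (t 0) k := by
    rw [Finset.sum_range_succ' _ n]
    simp [awEigenvalue]
  simp only [← mul_assoc] at h2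
  rw [h1, h2, ← Finset.sum_add_distrib]
  refine Finset.sum_congr rfl fun k _ => ?_
  rw [← add_mul, ← C_add]
  congr 2
  ring

/-! ### Continuous dependence of the eigenfunctions on the quartic -/

theorem awPhi_natDegree_le (E : Fin 5 → ℂ) : (awPhi E).natDegree ≤ 2 := natDegree_quadratic_le

theorem awPsi_natDegree_le (q : ℝ) (E : Fin 5 → ℂ) : (awPsi q E).natDegree ≤ 1 :=
  natDegree_linear_le

theorem awPhi_coeff (E : Fin 5 → ℂ) : (awPhi E).coeff 2 = E 0 + E 4 := by
  have : ∀ x y z : ℂ, (C x * X ^ 2 + C y * X + C z).coeff 2 = x := fun x y z => by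
    simp
  exact this _ _ _

theorem awPsi_coeff (q : ℝ) (E : Fin 5 → ℂ) :
    (awPsi q E).coeff 1 = 2 * (E 4 - E 0) / (sqrtQ q - (sqrtQ q)⁻¹) := by
  have : ∀ x y : ℂ, (C x * X + C y).coeff 1 = x := fun x y => by simp [coeff_C]
  exact this _ _

theorem leading_eq {q : ℝ} (hq0 : 0 < q) (hq1 : q < 1) (E : Fin 5 → ℂ) (n : ℤ) :
    (awPhi E).coeff 2 * gamma q n + (awPsi q E).coeff 1 * alpha q n
      = 2 / (sqrtQ q - (sqrtQ q)⁻¹) * (E 4 * sqrtQ q ^ n - E 0 * (sqrtQ q ^ n)⁻¹) := by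
  have hd := sqrtQ_sub_inv_ne_zero hq0 hq1
  rw [awPhi_coeff, awPsi_coeff, gamma_eq hq0, alpha_eq hq0]
  generalize (sqrtQ q ^ n)⁻¹ = y
  generalize sqrtQ q ^ n = z
  generalize sqrtQ q - (sqrtQ q)⁻¹ = d at *
  field_simp
  ring

theorem eigenvalue_eq {q : ℝ} (hq0 : 0 < q) (hq1 : q < 1) (E : Fin 5 → ℂ) (n : ℕ) :
    gamma q n * ((awPhi E).coeff 2 * gamma q ((n : ℤ) - 1)
      + (awPsi q E).coeff 1 * alpha q ((n : ℤ) - 1)) = awEigenvalue q E n := by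
  have hs := sqrtQ_ne_zero hq0
  have hd := sqrtQ_sub_inv_ne_zero hq0 hq1
  rw [leading_eq hq0 hq1, gamma_eq hq0, awEigenvalue, zpow_sub_one₀ hs, zpow_natCast,
    ← sqrtQ_sq hq0, ← pow_mul, mul_comm 2 n, pow_mul]
  have h1 : sqrtQ q ^ n ≠ 0 := pow_ne_zero _ hs
  generalize sqrtQ q - (sqrtQ q)⁻¹ = d at *
  generalize sqrtQ q ^ n = y at *
  field_simp

theorem awOp_natDegree_and_coeff {q : ℝ} (hq0 : 0 < q) (hq1 : q < 1) (E : Fin 5 → ℂ) {f : ℂ[X]}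
    {n : ℕ} (hf : f.natDegree ≤ n) :
    (awOp q E f).natDegree ≤ n ∧ (awOp q E f).coeff n = awEigenvalue q E n * f.coeff n := by
  have := secondOrder_natDegree_and_coeff hq0 hq1 (awPhi_natDegree_le E) (awPsi_natDegree_le q E) hf
  rwa [eigenvalue_eq hq0 hq1] at this

theorem awEigenvalue_sub {q : ℝ} (hq0 : 0 < q) (E : Fin 5 → ℂ) {m n : ℕ} (h : m < n) :
    awEigenvalue q E n - awEigenvalue q E m
      = 2 * sqrtQ q / (sqrtQ q - (sqrtQ q)⁻¹) ^ 2 * ((q : ℂ) ^ m)⁻¹ * ((q : ℂ) ^ (n - m) - 1)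
        * ((E 4 * (q : ℂ) ^ (n + m - 1) - E 0) / (q : ℂ) ^ (n - m) ) := by
  have hq : (q : ℂ) ≠ 0 := by exact_mod_cast hq0.ne'
  obtain ⟨k, rfl⟩ : ∃ k, n = m + 1 + k := ⟨n - m - 1, by omega⟩
  rw [awEigenvalue, awEigenvalue, show m + 1 + k - m = k + 1 by omega,
    show m + 1 + k + m - 1 = m + k + m by omega, pow_add, pow_add, pow_add, pow_add, pow_add,
    pow_one]
  have h1 : (q : ℂ) ^ m ≠ 0 := pow_ne_zero _ hq
  have h2 : (q : ℂ) ^ k ≠ 0 := pow_ne_zero _ hq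
  generalize (q : ℂ) ^ m = y at *
  generalize (q : ℂ) ^ k = z at *
  generalize 2 * sqrtQ q / (sqrtQ q - (sqrtQ q)⁻¹) ^ 2 = w
  field_simp
  ring

theorem awEigenvalue_sub_ne_zero {q : ℝ} (hq0 : 0 < q) (hq1 : q < 1) {E : Fin 5 → ℂ}
    (hE : ∀ n : ℕ, E 4 * (q : ℂ) ^ n - E 0 ≠ 0) {m n : ℕ} (h : m < n) :
    awEigenvalue q E n - awEigenvalue q E m ≠ 0 := by
  have hq : (q : ℂ) ≠ 0 := by exact_mod_cast hq0.ne'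
  rw [awEigenvalue_sub hq0 E h]
  refine mul_ne_zero (mul_ne_zero (mul_ne_zero (div_ne_zero (mul_ne_zero two_ne_zero
    (sqrtQ_ne_zero hq0)) (pow_ne_zero _ (sqrtQ_sub_inv_ne_zero hq0 hq1)))
    (inv_ne_zero (pow_ne_zero _ hq))) ?_) (div_ne_zero (hE _) (pow_ne_zero _ hq))
  exact sub_ne_zero.mpr (q_pow_ne_one hq0 hq1 (by omega))

theorem awOp_eq_sum (q : ℝ) (E : Fin 5 → ℂ) {f : ℂ[X]} {n : ℕ} (hf : f.natDegree ≤ n) :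
    awOp q E f = ∑ k ∈ Finset.range (n + 1), C (f.coeff k) * awOp q E (X ^ k) := by
  conv_lhs => rw [f.as_sum_range_C_mul_X_pow' (n := n + 1) (by omega)]
  rw [awOp_sum]
  exact Finset.sum_congr rfl fun k _ => awOp_C_mul _ _ _ _

/-- The coefficients of an eigenfunction of degree `n` are determined from the top down. -/
theorem coeff_eigenfunction {q : ℝ} (hq0 : 0 < q) (hq1 : q < 1) {E : Fin 5 → ℂ} {f : ℂ[X]}
    {n m : ℕ} (hf : f.natDegree ≤ n) (hm : m < n)
    (h : awOp q E f = C (awEigenvalue q E n) * f) :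
    (awEigenvalue q E n - awEigenvalue q E m) * f.coeff m
      = ∑ k ∈ Finset.Ioc m n, f.coeff k * (awOp q E (X ^ k)).coeff m := by
  have h1 : (awOp q E f).coeff m = awEigenvalue q E n * f.coeff m := by rw [h, coeff_C_mul]
  rw [awOp_eq_sum q E hf, finsetSum_coeff] at h1
  simp only [coeff_C_mul] at h1
  have h2 : ∑ k ∈ Finset.range (n + 1), f.coeff k * (awOp q E (X ^ k)).coeff m
      = ∑ k ∈ Finset.Icc m n, f.coeff k * (awOp q E (X ^ k)).coeff m := by
    symm
    refine Finset.sum_subset (fun k hk => ?_) fun k _ hk => ?_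
    · rw [Finset.mem_Icc] at hk; rw [Finset.mem_range]; omega
    · rename_i hk'
      rw [Finset.mem_range] at hk'
      rw [Finset.mem_Icc] at hk
      rw [coeff_eq_zero_of_natDegree_lt (p := awOp q E (X ^ k)), mul_zero]
      exact (awOp_natDegree_and_coeff hq0 hq1 E (natDegree_X_pow_le k)).1.trans_lt (by omega)
  rw [h2, ← Finset.Ioc_insert_left hm.le, Finset.sum_insert (by simp),
    (awOp_natDegree_and_coeff hq0 hq1 E (natDegree_X_pow_le m)).2, coeff_X_pow_self] at h1
  linear_combination -h1

theorem continuous_awOp_coeff (q : ℝ) (f : ℂ[X]) (m : ℕ) :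
    Continuous fun E => (awOp q E f).coeff m := by
  have : (fun E => (awOp q E f).coeff m) = fun E : Fin 5 → ℂ =>
      (E 0 + E 4) * (X ^ 2 * Dq q (Dq q f)).coeff m + (E 1 + E 3) / 2 * (X * Dq q (Dq q f)).coeff m
      + (E 2 - E 0 - E 4) / 2 * (Dq q (Dq q f)).coeff m
      + (2 * (E 4 - E 0) / (sqrtQ q - (sqrtQ q)⁻¹) * (X * Sq q (Dq q f)).coeff m
        + (E 3 - E 1) / (sqrtQ q - (sqrtQ q)⁻¹) * (Sq q (Dq q f)).coeff m) := by
    funext E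
    simp only [awOp, pearsonOp, awPhi, awPsi, add_mul, mul_assoc, coeff_add, coeff_C_mul]
  rw [this]
  fun_prop

theorem continuous_awEigenvalue (q : ℝ) (n : ℕ) : Continuous fun E => awEigenvalue q E n := by
  unfold awEigenvalue
  fun_prop

/-- Monic eigenfunctions converge coefficientwise when the quartics converge and the eigenvalues
of the limiting operator are distinct. -/
theorem tendsto_coeff_eigenfunction {ι : Type*} {l : Filter ι} {q : ℝ} (hq0 : 0 < q) (hq1 : q < 1)
    {E : ι → Fin 5 → ℂ} {E₀ : Fin 5 → ℂ} (hE : Tendsto E l (𝓝 E₀))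
    (hE₀ : ∀ n : ℕ, E₀ 4 * (q : ℂ) ^ n - E₀ 0 ≠ 0) {n : ℕ} {f : ι → ℂ[X]} {f₀ : ℂ[X]}
    (hd : ∀ᶠ t in l, (f t).natDegree ≤ n) (hc : ∀ᶠ t in l, (f t).coeff n = 1)
    (hf : ∀ᶠ t in l, awOp q (E t) (f t) = C (awEigenvalue q (E t) n) * f t)
    (hd₀ : f₀.natDegree ≤ n) (hc₀ : f₀.coeff n = 1)
    (hf₀ : awOp q E₀ f₀ = C (awEigenvalue q E₀ n) * f₀) (m : ℕ) :
    Tendsto (fun t => (f t).coeff m) l (𝓝 (f₀.coeff m)) := by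
  rcases lt_trichotomy n m with h | rfl | h
  · rw [coeff_eq_zero_of_natDegree_lt (hd₀.trans_lt h)]
    refine tendsto_const_nhds.congr' ?_
    filter_upwards [hd] with t ht
    rw [coeff_eq_zero_of_natDegree_lt (ht.trans_lt h)]
  · rw [hc₀]
    refine tendsto_const_nhds.congr' ?_
    filter_upwards [hc] with t ht
    rw [ht]
  · induction hk : n - m using Nat.strong_induction_on generalizing m with
    | _ k ih =>
      have hne := awEigenvalue_sub_ne_zero hq0 hq1 hE₀ h
      have hlim : ∀ j, Tendsto (fun t => awEigenvalue q (E t) j) l (𝓝 (awEigenvalue q E₀ j)) :=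
        fun j => ((continuous_awEigenvalue q j).tendsto E₀).comp hE
      have hsub := (hlim n).sub (hlim m)
      have hsum : Tendsto (fun t => ∑ k ∈ Finset.Ioc m n,
            (f t).coeff k * (awOp q (E t) (X ^ k)).coeff m) l
          (𝓝 (∑ k ∈ Finset.Ioc m n, f₀.coeff k * (awOp q E₀ (X ^ k)).coeff m)) := by
        refine tendsto_finsetSum _ fun j hj => ?_
        rw [Finset.mem_Ioc] at hj
        refine Tendsto.mul ?_ (((continuous_awOp_coeff q (X ^ j) m).tendsto E₀).comp hE)
        rcases hj.2.lt_or_eq with h1 | rfl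
        · exact ih (n - j) (by omega) j h1 rfl
        · rw [hc₀]
          refine tendsto_const_nhds.congr' ?_
          filter_upwards [hc] with t ht
          rw [ht]
      have h0 := coeff_eigenfunction hq0 hq1 hd₀ h hf₀
      rw [eq_div_of_mul_eq hne ((mul_comm _ _).trans h0)]
      refine (hsum.div hsub hne).congr' ?_
      filter_upwards [hd, hf, hsub.eventually_ne hne] with t h1 h2 h3
      rw [Pi.div_apply, ← coeff_eigenfunction hq0 hq1 h1 h h2]
      exact mul_div_cancel_left₀ _ h3

/-! ### Limits of Askey-Wilson polynomials -/

theorem awOp_smul (q : ℝ) (c : ℂ) (E : Fin 5 → ℂ) (f : ℂ[X]) :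
    awOp q (c • E) f = C c * awOp q E f := by
  have h1 : awPhi (c • E) = C c * awPhi E := by
    simp only [awPhi, Pi.smul_apply, smul_eq_mul, mul_add, ← mul_assoc, ← C_mul]
    congr 3 <;> ring_nf
  have h2 : awPsi q (c • E) = C c * awPsi q E := by
    simp only [awPsi, Pi.smul_apply, smul_eq_mul, mul_add, ← mul_assoc, ← C_mul]
    congr 3 <;> ring_nf
  rw [awOp, awOp, pearsonOp, pearsonOp, h1, h2]
  ring

theorem awEigenvalue_smul (q : ℝ) (c : ℂ) (E : Fin 5 → ℂ) (n : ℕ) :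
    awEigenvalue q (c • E) n = c * awEigenvalue q E n := by
  simp only [awEigenvalue, Pi.smul_apply, smul_eq_mul]
  ring

theorem awBase_natDegree_and_coeff (q : ℝ) (t : ℂ) (k : ℕ) :
    (awBase q t k).natDegree ≤ k ∧
      (awBase q t k).coeff k = ∏ j ∈ Finset.range k, -(2 * t * (q : ℂ) ^ j) := by
  induction k with
  | zero => simp [awBase_zero]
  | succ k ih =>
    have h1 : ∀ x y : ℂ, (1 - C x * X + C y).natDegree ≤ 1 := fun x y => by
      rw [show (1 - C x * X + C y : ℂ[X]) = C (-x) * X + C (1 + y) by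
        simp only [C_neg, C_add, C_1]; ring]
      exact natDegree_linear_le
    have h2 : ∀ x y : ℂ, (1 - C x * X + C y).coeff 1 = -x := fun x y => by
      simp [coeff_one, coeff_C]
    rw [awBase_succ]
    refine ⟨natDegree_mul_le.trans (add_le_add ih.1 (h1 _ _)), ?_⟩
    rw [coeff_mul_add_eq_of_natDegree_le ih.1 (h1 _ _), ih.2, h2, Finset.prod_range_succ]

theorem askeyWilson_natDegree_and_coeff (q : ℝ) (t : Fin 4 → ℂ) (n : ℕ) :
    (askeyWilson q t n).natDegree ≤ n ∧ (askeyWilson q t n).coeff n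
      = (t 0 ^ n)⁻¹ * (awCoeff q t n n * ∏ j ∈ Finset.range n, -(2 * t 0 * (q : ℂ) ^ j)) := by
  rw [askeyWilson_eq]
  have h : ∀ k, (C (awCoeff q t n k) * awBase q (t 0) k).natDegree ≤ k := fun k =>
    (natDegree_C_mul_le _ _).trans (awBase_natDegree_and_coeff q (t 0) k).1
  refine ⟨(natDegree_C_mul_le _ _).trans (natDegree_sum_le_of_forall_le _ _ fun k hk =>
    (h k).trans (by simpa [Nat.lt_succ_iff] using hk)), ?_⟩
  rw [coeff_C_mul, finsetSum_coeff, Finset.sum_range_succ, coeff_C_mul,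
    (awBase_natDegree_and_coeff q (t 0) n).2, Finset.sum_eq_zero, zero_add]
  intro k hk
  exact coeff_eq_zero_of_natDegree_lt ((h k).trans_lt (by simpa using hk))

theorem askeyWilson_coeff_ne_zero {q : ℝ} (hq0 : 0 < q) (hq1 : q < 1) {t : Fin 4 → ℂ}
    (ht : t 0 ≠ 0) {n : ℕ}
    (h : ∀ m < 2 * n, t 0 * t 1 * t 2 * t 3 * (q : ℂ) ^ m - 1 ≠ 0) :
    (askeyWilson q t n).coeff n ≠ 0 := by
  have hq : (q : ℂ) ≠ 0 := by exact_mod_cast hq0.ne'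
  rw [(askeyWilson_natDegree_and_coeff q t n).2, awCoeff, Nat.sub_self]
  have h1 : ∀ x, qPoch q x 0 = 1 := fun x => rfl
  rw [h1, h1, h1, mul_one, mul_one, mul_one]
  refine mul_ne_zero (inv_ne_zero (pow_ne_zero _ ht)) (mul_ne_zero (mul_ne_zero (div_ne_zero
    (mul_ne_zero ?_ ?_) (qPoch_self_ne_zero hq0 hq1 n)) (pow_ne_zero _ hq)) ?_)
  · refine Finset.prod_ne_zero_iff.mpr fun j hj h2 => ?_
    rw [Finset.mem_range] at hj
    apply q_pow_ne_one hq0 hq1 (n := n - j) (by omega)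
    rw [zpow_neg, zpow_natCast] at h2
    rw [pow_sub₀ _ hq hj.le]
    have hj0 : (q : ℂ) ^ j ≠ 0 := pow_ne_zero _ hq
    have hn0 : (q : ℂ) ^ n ≠ 0 := pow_ne_zero _ hq
    field_simp at h2 ⊢
    linear_combination h2
  · refine Finset.prod_ne_zero_iff.mpr fun j hj h2 => ?_
    rw [Finset.mem_range] at hj
    apply h (n - 1 + j) (by omega)
    rw [mul_assoc, ← zpow_natCast (q : ℂ) j, ← zpow_add₀ hq,
      show (n : ℤ) - 1 + (j : ℤ) = ((n - 1 + j : ℕ) : ℤ) by omega, zpow_natCast] at h2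
    linear_combination -h2
  · exact Finset.prod_ne_zero_iff.mpr fun j _ =>
      neg_ne_zero.mpr (mul_ne_zero (mul_ne_zero two_ne_zero ht) (pow_ne_zero _ hq))

/-- The factor that makes the Askey-Wilson polynomial monic, when its degree is `n`. -/
def awNormalizer (q : ℝ) (n : ℕ) (t : Fin 4 → ℂ) : ℂ :=
  if (askeyWilson q t n).coeff n = 0 then 1 else ((askeyWilson q t n).coeff n)⁻¹

theorem awNormalizer_ne_zero (q : ℝ) (n : ℕ) (t : Fin 4 → ℂ) : awNormalizer q n t ≠ 0 := by
  unfold awNormalizer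
  split_ifs with h
  · exact one_ne_zero
  · exact inv_ne_zero h

/-- If the quartics `∏ (1 - t_i w)`, suitably rescaled, converge along `l` to the quartic of a
sequence of monic eigenfunctions, then the Askey-Wilson polynomials, suitably rescaled, converge
to this sequence. -/
theorem tendsto_askeyWilson {q : ℝ} (hq0 : 0 < q) (hq1 : q < 1) {P : ℕ → ℂ[X]}
    (hd : ∀ n, (P n).natDegree = n) (hm : ∀ n, (P n).Monic) {E₀ : Fin 5 → ℂ}
    (hE₀ : ∀ n : ℕ, E₀ 4 * (q : ℂ) ^ n - E₀ 0 ≠ 0)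
    (hP : ∀ n, awOp q E₀ (P n) = C (awEigenvalue q E₀ n) * P n)
    {l : Filter (Fin 4 → ℂ)} {σ : (Fin 4 → ℂ) → ℂ} (ht : ∀ᶠ t in l, t 0 ≠ 0)
    (hσ : Tendsto (fun t => σ t • quarticCoeff t 1) l (𝓝 E₀)) (n m : ℕ) :
    Tendsto (fun t => awNormalizer q n t * (askeyWilson q t n).coeff m) l
      (𝓝 ((P n).coeff m)) := by
  have hne : ∀ᶠ t in l, (askeyWilson q t n).coeff n ≠ 0 := by
    have h1 : ∀ᶠ t in l, ∀ m ∈ Finset.range (2 * n),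
        (σ t • quarticCoeff t 1) 4 * (q : ℂ) ^ m - (σ t • quarticCoeff t 1) 0 ≠ 0 := by
      rw [Filter.eventually_all_finset]
      intro m _
      have hc : ∀ i, Tendsto (fun t => (σ t • quarticCoeff t 1) i) l (𝓝 (E₀ i)) :=
        fun i => (tendsto_pi_nhds.mp hσ) i
      exact (((hc 4).mul_const _).sub (hc 0)).eventually_ne (hE₀ m)
    filter_upwards [ht, h1] with t h2 h3
    refine askeyWilson_coeff_ne_zero hq0 hq1 h2 fun m hm h4 => h3 m (Finset.mem_range.mpr hm) ?_
    simp only [Pi.smul_apply, smul_eq_mul, quarticCoeff, Matrix.cons_val, Pi.one_apply, mul_one]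
    linear_combination σ t * h4
  have h := tendsto_coeff_eigenfunction hq0 hq1 hσ hE₀ (n := n)
    (f := fun t => C (awNormalizer q n t) * askeyWilson q t n) (f₀ := P n)
    (Eventually.of_forall fun t => (natDegree_C_mul_le _ _).trans
      (askeyWilson_natDegree_and_coeff q t n).1)
    (by
      filter_upwards [hne] with t h1
      rw [coeff_C_mul, awNormalizer, if_neg h1, inv_mul_cancel₀ h1])
    (Eventually.of_forall fun t => by
      rw [awOp_smul, awOp_C_mul, awOp_askeyWilson hq0 hq1, awEigenvalue_smul, C_mul]
      ring)
    (hd n).le (by have := (hm n).coeff_natDegree; rwa [hd n] at this) (hP n) m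
  simpa only [coeff_C_mul] using h

/-! ### Classification -/

theorem prod_eq_sum_quarticCoeff (x y : Fin 4 → ℂ) :
    ∏ i, (C (y i) - C (x i) * X) = ∑ j : Fin 5, C (quarticCoeff x y j) * X ^ (j : ℕ) := by
  simp only [Fin.prod_univ_four, Fin.sum_univ_five, quarticCoeff, Matrix.cons_val, Fin.isValue,
    Fin.val_zero, Fin.val_one, Fin.val_two, C_add, C_neg, C_mul, pow_zero, pow_one]
  simp only [show ((3 : Fin 5) : ℕ) = 3 from rfl, show ((4 : Fin 5) : ℕ) = 4 from rfl]
  ring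

theorem sum_C_mul_X_pow_injective {a b : Fin 5 → ℂ}
    (h : ∑ j : Fin 5, C (a j) * X ^ (j : ℕ) = ∑ j : Fin 5, C (b j) * X ^ (j : ℕ)) : a = b := by
  have key : ∀ (e : Fin 5 → ℂ) (i : Fin 5),
      (∑ j : Fin 5, C (e j) * X ^ (j : ℕ)).coeff (i : ℕ) = e i := fun e i => by
    simp [finsetSum_coeff, coeff_X_pow, Fin.val_inj]
  funext i
  rw [← key a i, h, key b i]

theorem quarticCoeff_comp_perm (x y : Fin 4 → ℂ) (π : Equiv.Perm (Fin 4)) :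
    quarticCoeff (x ∘ π) (y ∘ π) = quarticCoeff x y := by
  apply sum_C_mul_X_pow_injective
  rw [← prod_eq_sum_quarticCoeff, ← prod_eq_sum_quarticCoeff]
  exact Equiv.prod_comp π fun i => C (y i) - C (x i) * X

theorem quarticCoeff_mul (c x y : Fin 4 → ℂ) :
    quarticCoeff (c * x) (c * y) = (∏ i, c i) • quarticCoeff x y := by
  apply sum_C_mul_X_pow_injective
  rw [← prod_eq_sum_quarticCoeff]
  simp only [Pi.smul_apply, smul_eq_mul, C_mul, mul_assoc, ← Finset.mul_sum]
  rw [← prod_eq_sum_quarticCoeff, map_prod, ← Finset.prod_mul_distrib]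
  refine Finset.prod_congr rfl fun i _ => ?_
  simp only [Pi.mul_apply, C_mul]
  ring

theorem exists_roots_quartic {E : Fin 5 → ℂ} (h : E 4 ≠ 0) :
    ∃ ρ : Fin 4 → ℂ, E = E 4 • quarticCoeff 1 ρ := by
  set p : ℂ[X] := ∑ j : Fin 5, C (E j) * X ^ (j : ℕ) with hp
  have hp' : p = C (E 4) * X ^ 4 + (C (E 3) * X ^ 3 + C (E 2) * X ^ 2 + C (E 1) * X + C (E 0)) := by
    rw [hp, Fin.sum_univ_five]
    simp only [Fin.val_zero, Fin.val_one, Fin.val_two, pow_zero, pow_one, mul_one,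
      show ((3 : Fin 5) : ℕ) = 3 from rfl, show ((4 : Fin 5) : ℕ) = 4 from rfl]
    ring
  have hlt : (C (E 3) * X ^ 3 + C (E 2) * X ^ 2 + C (E 1) * X + C (E 0)).degree
      < (C (E 4) * X ^ 4 : ℂ[X]).degree := by
    rw [degree_C_mul_X_pow 4 h]
    exact degree_cubic_lt
  have hdeg : p.natDegree = 4 := by
    rw [hp']
    exact natDegree_eq_of_degree_eq_some
      ((degree_add_eq_left_of_degree_lt hlt).trans (degree_C_mul_X_pow 4 h))
  have hlead : p.leadingCoeff = E 4 := by
    rw [hp', leadingCoeff_add_of_degree_lt' hlt, leadingCoeff_C_mul_X_pow]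
  have hsplit := IsAlgClosed.splits p
  have hcard := hsplit.natDegree_eq_card_roots
  rw [hdeg, eq_comm, Multiset.card_eq_four] at hcard
  obtain ⟨x, y, z, w, hr⟩ := hcard
  refine ⟨![x, y, z, w], sum_C_mul_X_pow_injective ?_⟩
  rw [← hp, hsplit.eq_prod_roots, hlead, hr]
  simp only [Pi.smul_apply, smul_eq_mul, C_mul, mul_assoc, ← Finset.mul_sum]
  rw [← prod_eq_sum_quarticCoeff]
  congr 1
  simp [Fin.prod_univ_four]
  ring

/-- Zeros among the `t_i` account for a degree less than four. -/
theorem exists_reciprocal_roots_quartic {E : Fin 5 → ℂ} (h : E 0 ≠ 0) :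
    ∃ t : Fin 4 → ℂ, E = E 0 • quarticCoeff t 1 := by
  obtain ⟨t, ht⟩ := exists_roots_quartic (E := E ∘ Fin.rev) (by simpa using h)
  refine ⟨t, ?_⟩
  funext j
  have h1 := congrFun ht (Fin.rev j)
  simp only [Function.comp_apply, Fin.rev_rev, Pi.smul_apply, smul_eq_mul,
    show Fin.rev (4 : Fin 5) = 0 from rfl] at h1
  rw [h1, Pi.smul_apply, smul_eq_mul]
  congr 1
  fin_cases j <;> simp [quarticCoeff, Fin.rev] <;> ring

theorem continuous_quarticCoeff :
    Continuous fun x : (Fin 4 → ℂ) × (Fin 4 → ℂ) => quarticCoeff x.1 x.2 := by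
  refine continuous_pi fun j => ?_
  fin_cases j <;> simp only [quarticCoeff, Fin.zero_eta, Fin.mk_one, Fin.reduceFinMk,
    Matrix.cons_val] <;> fun_prop

/-- Every monic sequence of eigenfunctions of a second-order operator with distinct eigenvalues
consists of Askey-Wilson polynomials or limits of them. If the quartic `H` of the operator has
`H(0) ≠ 0`, the parameters are the reciprocals of its roots, completed by zeros; if `H(0) = 0`,
the roots at `0` correspond to parameters that tend to infinity. -/
theorem isAskeyWilsonFamily_of_eigenfunctions {q : ℝ} (hq0 : 0 < q) (hq1 : q < 1) {P : ℕ → ℂ[X]}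
    (hd : ∀ n, (P n).natDegree = n) (hm : ∀ n, (P n).Monic) {E : Fin 5 → ℂ}
    (hE : ∀ n : ℕ, E 4 * (q : ℂ) ^ n - E 0 ≠ 0)
    (hP : ∀ n, awOp q E (P n) = C (awEigenvalue q E n) * P n) : IsAskeyWilsonFamily q P := by
  by_cases h0 : E 0 = 0
  · have h4 : E 4 ≠ 0 := by
      have := hE 0
      rwa [h0, pow_zero, mul_one, sub_zero] at this
    obtain ⟨ρ, hρ⟩ := exists_roots_quartic h4
    have hex : ∃ i, ρ i = 0 := by
      have h1 := congrFun hρ 0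
      rw [h0, Pi.smul_apply, smul_eq_mul, eq_comm] at h1
      have h2 := (mul_eq_zero.mp h1).resolve_left h4
      simp only [quarticCoeff, Matrix.cons_val, mul_eq_zero] at h2
      rcases h2 with ((h2 | h2) | h2) | h2 <;> exact ⟨_, h2⟩
    right; right
    classical
    set F : Fin 4 → Filter ℂ :=
      fun i => if ρ i = 0 then Bornology.cobounded ℂ else pure (ρ i)⁻¹ with hF
    refine ⟨{i | ρ i = 0}, F, hex, fun i hi => if_pos hi,
      fun i hi => ⟨(ρ i)⁻¹, inv_ne_zero hi, if_neg hi⟩,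
      fun n t => awNormalizer q n t, fun n t => awNormalizer_ne_zero q n t, ?_⟩
    have hne : ∀ i, ∀ᶠ t in Filter.pi F, t i ≠ 0 := by
      intro i
      refine (tendsto_eval_pi F i).eventually (p := fun z => z ≠ 0) ?_
      by_cases hi : ρ i = 0
      · simp only [hF, if_pos hi]
        exact Bornology.eventually_ne_cobounded 0
      · simp only [hF, if_neg hi]
        exact eventually_pure.mpr (inv_ne_zero hi)
    have hinv : Tendsto (fun t : Fin 4 → ℂ => fun i => (t i)⁻¹) (Filter.pi F) (𝓝 ρ) := by
      refine tendsto_pi_nhds.mpr fun i => ?_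
      have h1 : Tendsto (fun z : ℂ => z⁻¹) (F i) (𝓝 (ρ i)) := by
        by_cases hi : ρ i = 0
        · simp only [hF, if_pos hi, hi]
          exact tendsto_inv₀_cobounded
        · simp only [hF, if_neg hi]
          have := tendsto_pure_nhds (fun z : ℂ => z⁻¹) (ρ i)⁻¹
          rwa [inv_inv] at this
      exact h1.comp (tendsto_eval_pi F i)
    refine tendsto_askeyWilson hq0 hq1 hd hm hE hP (σ := fun t => E 4 * ∏ i, (t i)⁻¹) (hne 0) ?_
    have h1 : Tendsto (fun t : Fin 4 → ℂ => E 4 • quarticCoeff 1 fun i => (t i)⁻¹) (Filter.pi F)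
        (𝓝 (E 4 • quarticCoeff 1 ρ)) :=
      ((continuous_quarticCoeff.tendsto (1, ρ)).comp (tendsto_const_nhds.prodMk_nhds hinv)).const_smul
        (E 4)
    rw [← hρ] at h1
    refine h1.congr' ?_
    filter_upwards [eventually_all.mpr hne] with t ht
    rw [mul_smul, ← quarticCoeff_mul (fun i => (t i)⁻¹) t 1]
    congr 2
    · funext i
      exact (inv_mul_cancel₀ (ht i)).symm
    · exact (mul_one _).symm
  · obtain ⟨t, ht⟩ := exists_reciprocal_roots_quartic h0
    by_cases hz : ∀ i, t i = 0
    · right; left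
      refine ⟨fun n t => awNormalizer q n t, fun n t => awNormalizer_ne_zero q n t, ?_⟩
      have hle : Filter.pi (fun _ : Fin 4 => 𝓝[≠] (0 : ℂ)) ≤ 𝓝 t := by
        rw [nhds_pi, show t = 0 from funext hz]
        exact Filter.pi_mono fun _ => nhdsWithin_le_nhds
      refine tendsto_askeyWilson hq0 hq1 hd hm hE hP (σ := fun _ => E 0)
        ((tendsto_eval_pi (fun _ : Fin 4 => 𝓝[≠] (0 : ℂ)) 0).eventually (p := fun z => z ≠ 0)
          self_mem_nhdsWithin) ?_
      have h1 : Tendsto (fun x : Fin 4 → ℂ => E 0 • quarticCoeff x 1) (𝓝 t)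
          (𝓝 (E 0 • quarticCoeff t 1)) :=
        ((continuous_quarticCoeff.tendsto (t, 1)).comp
          (tendsto_id.prodMk_nhds tendsto_const_nhds)).const_smul (E 0)
      rw [← ht] at h1
      exact h1.mono_left hle
    · left
      push Not at hz
      obtain ⟨i, hi⟩ := hz
      -- the Askey-Wilson polynomials require the first parameter to be nonzero
      set t' := t ∘ Equiv.swap 0 i with ht'
      have h1 : quarticCoeff t' 1 = quarticCoeff t 1 := quarticCoeff_comp_perm t 1 _
      have h2 : t' 0 ≠ 0 := by simpa [ht'] using hi
      refine ⟨t', h2, fun n => ⟨awNormalizer q n t', awNormalizer_ne_zero q n t', ?_⟩⟩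
      ext m
      have h3 := tendsto_askeyWilson hq0 hq1 hd hm hE hP (l := pure t') (σ := fun _ => E 0)
        (eventually_pure.mpr h2)
        (by
          have := tendsto_pure_nhds (fun x : Fin 4 → ℂ => E 0 • quarticCoeff x 1) t'
          rwa [h1, ← ht] at this) n m
      rw [coeff_C_mul]
      exact tendsto_nhds_unique h3 (tendsto_pure_nhds _ t')

theorem IsMonicOPS.isAskeyWilsonFamily {q : ℝ} (hq0 : 0 < q) (hq1 : q < 1)
    {u : ℂ[X] →ₗ[ℂ] ℂ} {P : ℕ → ℂ[X]} (hP : IsMonicOPS u P) {A B C' b : ℂ}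
    (h : ∀ f, u (pearsonOp q (C A * X ^ 2 + C B * X + C C') (X - C b) f) = 0) :
    IsAskeyWilsonFamily q P := by
  have hs := sqrtQ_ne_zero hq0
  have hd := sqrtQ_sub_inv_ne_zero hq0 hq1
  set d := sqrtQ q - (sqrtQ q)⁻¹ with hd'
  set E : Fin 5 → ℂ := ![(A - d / 2) / 2, B + d * b / 2, 2 * C' + A, B - d * b / 2,
    (A + d / 2) / 2] with hE
  have hφ : C A * X ^ 2 + C B * X + C C' = awPhi E := by
    simp only [awPhi, hE, Matrix.cons_val]
    congr 3 <;> ring_nf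
  have hψ : X - C b = awPsi q E := by
    simp only [awPsi, hE, Matrix.cons_val, ← hd']
    rw [show 2 * ((A + d / 2) / 2 - (A - d / 2) / 2) / d = 1 by field_simp; ring,
      show (B - d * b / 2 - (B + d * b / 2)) / d = -b by field_simp; ring, C_1, C_neg]
    ring
  rw [hφ, hψ] at h
  have hψ1 : (awPsi q E).coeff 1 ≠ 0 := by rw [← hψ]; simp
  refine isAskeyWilsonFamily_of_eigenfunctions hq0 hq1 hP.natDegree hP.monic (E := E)
    (fun n hn => ?_) fun n => ?_
  · refine hP.leading_ne_zero hq0 hq1 (awPhi_natDegree_le E) (awPsi_natDegree_le q E) hψ1 h n ?_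
    have hsn : sqrtQ q ^ n ≠ 0 := pow_ne_zero _ hs
    rw [leading_eq hq0 hq1, zpow_natCast]
    have h1 : E 4 * sqrtQ q ^ n - E 0 * (sqrtQ q ^ n)⁻¹
        = (sqrtQ q ^ n)⁻¹ * (E 4 * (q : ℂ) ^ n - E 0) := by
      rw [← sqrtQ_sq hq0]; field_simp; ring
    rw [h1, hn, mul_zero, mul_zero]
  · rw [awOp, hP.secondOrder_eq hq0 hq1 (awPhi_natDegree_le E) (awPsi_natDegree_le q E) h,
      eigenvalue_eq hq0 hq1]

end AskeyWilson

end

theorem theorem3p1 (q : ℝ) (hq0 : 0 < q) (hq1 : q < 1)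
    (u : ℂ[X] →ₗ[ℂ] ℂ) (P : ℕ → ℂ[X]) (hP : AskeyWilson.IsMonicOPS u P)
    (a b c : ℂ) (an bn cn : ℕ → ℂ) (hcn : ∀ n, cn n ≠ 0)
    (heq : ∀ n : ℕ,
      (C a * X ^ 2 + C b * X + C c) * AskeyWilson.Dq q (P n)
        = C (an n) * AskeyWilson.Sq q (P (n + 1)) + C (bn n) * AskeyWilson.Sq q (P n)
          + C (cn n) * AskeyWilson.Sq q (AskeyWilson.prevPoly P n))
    (B Cc : ℕ → ℂ) (hB : B = AskeyWilson.recB u P) (hCc : Cc = AskeyWilson.recC u P)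
    (α r₂ r₃ : ℂ) (hα : α = AskeyWilson.alpha q 1)
    (hr₂ : r₂ = cn 2 + 2 * a * Cc 2) (hr₃ : r₃ = cn 3 + 2 * a * Cc 3)
    (hcond₁ : a ≠ 0 →
      (4 * α ^ 2 - 1) * a * Cc 2 * Cc 3
        + r₃ / 2 * ((B 0 + B 1) ^ 2 + 4 * α ^ 2 * (Cc 1 - B 0 * B 1 + α ^ 2 - 1)
            - 2 * (2 * α ^ 2 - 1) * Cc 2) = 0)
    (hcond₂ :
      a * Cc 2 * Cc 3 * (bn 2 + 2 * a * B 2 + b / α)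
        - r₃ * (a * (B 2 + B 1) * Cc 2 + b / α * Cc 2 - r₂ / 2 * (B 1 - B 0)) = 0)
    (A B' C' : ℂ)
    (hA : A = -((a * Cc 3 + (α ^ 2 - 1) * r₃) / (α * r₃)))
    (hB' : B' = -(1 / (2 * α)) *
      ((1 - 2 * a * (Cc 3 / r₃)) * (B 0 + B 1) - 2 * α ^ 2 * B 0))
    (hC' : C' = -(1 / (2 * α)) *
      ((1 - 2 * a * (Cc 3 / r₃)) * (Cc 1 - B 0 * B 1) + Cc 1 + B 0 ^ 2))
    (φ ψ : ℂ[X]) (hφ : φ = C A * X ^ 2 + C B' * X + C C') (hψ : ψ = X - C (B 0)) :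
    r₃ ≠ 0 ∧
    AskeyWilson.IsAskeyWilsonFamily q P ∧
    AskeyWilson.functionalDq q (AskeyWilson.polyMul φ u)
      = AskeyWilson.functionalSq q (AskeyWilson.polyMul ψ u) ∧
    ∀ n : ℕ,
      φ * AskeyWilson.Dq q (AskeyWilson.Dq q (P n)) + ψ * AskeyWilson.Sq q (AskeyWilson.Dq q (P n))
        = C (AskeyWilson.gamma q n *
            (A * AskeyWilson.gamma q ((n : ℤ) - 1) + AskeyWilson.alpha q ((n : ℤ) - 1))) * P n := by
  have hS := AskeyWilson.gamma_succ hq0 hq1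
  have hγ3 : 4 * α ^ 2 - 1 ≠ 0 := by
    have h3 := AskeyWilson.gamma_ne_zero hq0 hq1 three_ne_zero
    have h2 := AskeyWilson.alpha_succ hq0 hq1 1
    rw [show ((3 : ℕ) : ℤ) = 1 + 1 + 1 by norm_num, hS, hS, h2,
      AskeyWilson.gamma_one hq0 hq1, ← hα] at h3
    intro h
    apply h3
    linear_combination h
  have hC : ∀ n, Cc (n + 1) ≠ 0 := by rw [hCc]; exact hP.recC_succ_ne_zero
  have hr : r₃ ≠ 0 := by
    intro h
    by_cases ha : a = 0
    · rw [h, ha] at hr₃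
      exact hcn 3 (by linear_combination -hr₃)
    · have h1 := hcond₁ ha
      rw [h, zero_div, zero_mul, add_zero] at h1
      exact mul_ne_zero (mul_ne_zero (mul_ne_zero hγ3 ha) (hC 1)) (hC 2) h1
  have hpear : ∀ f, u (AskeyWilson.pearsonOp q φ ψ f) = 0 := by
    rw [hφ, hψ]
    exact AskeyWilson.pearson_of_structure hq0 hq1 hP hcn heq hB hCc hα hr₂ hr₃ hcond₁ hcond₂ hr
      hA hB' hC'
  refine ⟨hr, ?_, ?_, fun n => ?_⟩
  · rw [hφ, hψ] at hpear
    exact hP.isAskeyWilsonFamily hq0 hq1 hpear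
  · refine LinearMap.ext fun f => ?_
    have h1 : u (φ * AskeyWilson.Dq q f) + u (ψ * AskeyWilson.Sq q f) = 0 := by
      rw [← map_add]
      exact hpear f
    exact neg_eq_of_add_eq_zero_right h1
  · have hφ2 : φ.coeff 2 = A := by
      have : ∀ x y z : ℂ, (C x * X ^ 2 + C y * X + C z).coeff 2 = x := fun x y z => by
        simp
      rw [hφ, this]
    have hψ1 : ψ.coeff 1 = 1 := by rw [hψ]; simp
    have h1 := hP.secondOrder_eq hq0 hq1 (hφ ▸ natDegree_quadratic_le)
      (hψ ▸ (natDegree_X_sub_C (B 0)).le) hpear n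
    rw [hφ2, hψ1, one_mul] at h1
    exact h1
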